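/- **Theorem (Identifiability of pairwise mean independent component analysis).** A random vector $s=(s_1,\dots,s_n)$ with integrable real coordinates is *pairwise mean independent* (PMI) if $\mathbb{E}(s_i\mid s_j)=\mathbb{E}(s_i)$ almost surely for all $i\neq j$. For a random vector $z$ in $\mathbb{R}^n$ with finite $d$-th absolute moments, let $\kappa_d(z)$ be its $d$-th cumulant tensor, $$\kappa_d(z)_{i_1\dots i_d}=\sum_{\pi}(-1)^{|\pi|-1}(|\pi|-1)!\prod_{B\in\pi}\mathbb{E}\Big(\prod_{k\in B}z_{i_k}\Big),$$ where $\pi$ runs over the partitions of $\{1,\dots,d\}$ and $|\pi|$ is the number of blocks. Let $$V_{\mathrm{pmi}}^{d,n}=\{T\in S^d(\mathbb{R}^n) : T_{ij\dots j}=0 \text{ for all } i\neq j\},$$ where $S^d(\mathbb{R}^n)$ is the space of real symmetric tensors of order $d$. If all $s_i$ have finite nonzero variance, write $\tilde s_i=(s_i-\mathbb{E}s_i)/\sqrt{\operatorname{Var}(s_i)}$ and $\tilde s=(\tilde s_1,\dots,\tilde s_n)$. Let $n\ge 0$ and $d\geq 3$ be integers. There is a polynomial $P=P_{n,d}$ with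 real coefficients in the entries of an order-$d$ tensor of format $n\times\cdots\times n$ such that: 1. $P$ does not vanish identically on $V_{\mathrm{pmi}}^{d,n}$, and there is a PMI random vector $s$ in $\mathbb{R}^n$, with coordinates of nonzero variance and finite $d$-th absolute moments, for which $P(\kappa_d(\tilde s))\neq 0$. 2. Let $s$ be any PMI random vector in $\mathbb{R}^n$ whose coordinates have nonzero variance and finite $d$-th absolute moments, and suppose that $P(\kappa_d(\tilde s))\neq 0$ (that is, $s$ is sufficiently general). Let $A\in\mathbb{R}^{n\times n}$ be invertible and $x=As$. Then $A$ is identifiable from the distribution of $x$, up to permutation and scaling of columns: if $s'$ is any PMI random vector (possibly on another probability space) and $B\in\mathbb{R}^{n\times n}$ is any invertible matrix such that $Bs'$ and $As$ have the same distribution, then there are a permutation $\sigma$ of $\{1,\dots,n\}$ and nonzero real numbers $c_1,\dots,c_n$ such that, for every $j$, column $\sigma(j)$ of $B$ equals $c_j$ times column $j$ of $A$. -/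

import Mathlib

open MeasureTheory ProbabilityTheory

noncomputable section

/-- The order-`d` cumulant tensor `κ_d(z)` of a random vector `z` in `ℝⁿ` under `μ`, by the
cumulant-moment relation: the `(i_1, …, i_d)` entry is the sum over all partitions `π` of
`{1, …, d}` of `(-1)^(|π| - 1) (|π| - 1)! ∏_{B ∈ π} 𝔼 (∏_{k ∈ B} z_{i_k})`.
It is meaningful as soon as the coordinates of `z` have finite `d`-th absolute moments. -/
def cumulantTensor {Ω : Type*} [MeasurableSpace Ω] {n : ℕ} (μ : Measure Ω)
    (z : Ω → Fin n → ℝ) (d : ℕ) (idx : Fin d → Fin n) : ℝ :=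
  ∑ π : Finpartition (Finset.univ : Finset (Fin d)),
    (-1 : ℝ) ^ (π.parts.card - 1) * (Nat.factorial (π.parts.card - 1) : ℝ) *
      ∏ B ∈ π.parts, ∫ ω, ∏ k ∈ B, z ω (idx k) ∂μ

/-- The space `V_pmi` of real symmetric tensors of format `n × ⋯ × n` (`d` times) all of whose
entries `T_{i j ⋯ j}` with `i ≠ j` vanish (the index `i` may sit at any position `k`, which by
symmetry is the same condition). -/
def Vpmi (d n : ℕ) : Set ((Fin d → Fin n) → ℝ) :=
  {T | (∀ (σ : Equiv.Perm (Fin d)) (idx : Fin d → Fin n), T (idx ∘ σ) = T idx) ∧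
    ∀ (k : Fin d) (i j : Fin n), i ≠ j → T (Function.update (fun _ => j) k i) = 0}

/-- Pairwise mean independence of a random vector with integrable coordinates:
`𝔼 (z_i | z_j) = 𝔼 (z_i)` almost surely, for all `i ≠ j`. -/
def PairwiseMeanIndep {Ω : Type*} [MeasurableSpace Ω] {n : ℕ} (μ : Measure Ω)
    (z : Ω → Fin n → ℝ) : Prop :=
  (∀ i, Integrable (fun ω => z ω i) μ) ∧
    ∀ i j, i ≠ j →
      μ[fun ω => z ω i | MeasurableSpace.comap (fun ω => z ω j) inferInstance]
        =ᵐ[μ] fun _ => ∫ ω, z ω i ∂μ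

/-- The coordinatewise standardization of a random vector: every coordinate is shifted to mean
zero and scaled to variance one. For uncorrelated coordinates with nonzero variances this is the
whitening of `z`. -/
def standardize {Ω : Type*} [MeasurableSpace Ω] {n : ℕ} (μ : Measure Ω)
    (z : Ω → Fin n → ℝ) : Ω → Fin n → ℝ :=
  fun ω i => (z ω i - ∫ ω', z ω' i ∂μ) / Real.sqrt (variance (fun ω' => z ω' i) μ)

/-- Admissible sources for cumulants of order `d`: a measurable pairwise mean independent random
vector whose coordinates are non-degenerate and have finite `d`-th absolute moments. -/
structure IsPMISource {Ω : Type*} [MeasurableSpace Ω] {n : ℕ} (μ : Measure Ω)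
    (d : ℕ) (s : Ω → Fin n → ℝ) : Prop where
  measurable : Measurable s
  pmi : PairwiseMeanIndep μ s
  memLp : ∀ i, MemLp (fun ω => s ω i) (d : ENNReal) μ
  variance_ne_zero : ∀ i, variance (fun ω => s ω i) μ ≠ 0

end

/-! Put `M = B⁻¹ A`. Standardizing both sources turns `M` into an orthogonal `Q`, equal to `M` up to
diagonal scalings, that carries the law of the standardized `s` to that of the standardized `s'`
(`exists_orthogonal_of_map_eq`). Both cumulant tensors lie in `Vpmi`. By multilinearity of
cumulants, vanishing of the entries `i j ⋯ j` for `s'` says `T(Q_i, Q_j, …, Q_j) = 0` for the rows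
of `Q` and `T = κ_d` of the standardized `s`; hence the rows form an orthonormal basis of
eigenvectors of `T`. So it suffices that a generic `T` in `Vpmi` has no orthonormal eigenbasis other
than signed permutations of the standard one (`eventually_orthogonal_eigenbasis_monomial`).

This follows by counting dimensions: `N` independent linear conditions on `T`, depending on `N`
parameters confined to a hypersurface, fail for generic `T` (`eventually_not_linear_conditions`).
Every eigenvector that is not a multiple of a coordinate vector therefore avoids any prescribed
hypersurface, in particular those where a coordinate or a signed sum of squares vanishes. In order
at least four, two such eigenvectors cannot be orthogonal, because the two systems of eigenvector
equations are jointly independent on `Vpmi` (`eq_zero_of_contract_add_contract_eq_zero`). In order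
three the eigenvalue of a member of an orthonormal eigenbasis is the partial trace of `T` at that
vector. Substituting this eigenvalue gives `n` independent equations, again too many.

For the existence of a source, a uniform product law on a grid is perturbed so that its `d`-th
cumulant moves by a small prescribed element of `Vpmi` (`cumulantTensor_gridMeasure`); the
polynomial is then restricted to a line. -/

/-! ### Elimination by counting dimensions -/

/-- In a polynomial ring in as many variables as there are entries of `F`, the values of `F` on the
zero locus of a nonzero polynomial satisfy a nontrivial polynomial relation. -/
theorem MvPolynomial.exists_relation_on_zeroLocus {β τ : Type} [Fintype β] [Fintype τ]
    (hcard : Fintype.card τ ≤ Fintype.card β) (F : β → MvPolynomial τ ℝ)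
    {R : MvPolynomial τ ℝ} (hR : R ≠ 0) :
    ∃ G : MvPolynomial β ℝ, G ≠ 0 ∧
      ∀ q : τ → ℝ, aeval q R = 0 → aeval (fun i => aeval q (F i)) G = 0 := by
  by_cases hF : AlgebraicIndependent ℝ F
  · have hb : IsTranscendenceBasis ℝ F := by
      refine hF.isTranscendenceBasis_of_trdeg_le_of_finite ?_
      rw [MvPolynomial.trdeg_of_isDomain]
      simpa using hcard
    have hAlg := hb.isAlgebraic
    -- By the count of variables, `R` is algebraic over the subalgebra generated by `F`, so some
    -- nonzero `G(F)` is a multiple of `R` and vanishes where `R` does.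
    obtain ⟨r, hr0, S, hS⟩ := (Algebra.IsAlgebraic.isAlgebraic
      (R := Algebra.adjoin ℝ (Set.range F)) R).exists_nonzero_dvd (mem_nonZeroDivisors_of_ne_zero hR)
    obtain ⟨r, hr⟩ := r
    rw [Algebra.adjoin_range_eq_range_aeval] at hr
    obtain ⟨G, rfl⟩ := hr
    refine ⟨G, ?_, fun q hq => ?_⟩
    · rintro rfl
      exact hr0 (Subtype.ext (by simp))
    · have h1 : (aeval q) ((aeval F) G) = aeval (fun i => aeval q (F i)) G := by
        rw [← AlgHom.comp_apply, comp_aeval]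
      have h2 : (aeval F) G = R * S := hS
      rw [← h1, h2, map_mul, hq, zero_mul]
  · rw [algebraicIndependent_iff] at hF
    push Not at hF
    obtain ⟨G, hG, hG0⟩ := hF
    refine ⟨G, hG0, fun q _ => ?_⟩
    have h1 : (aeval q) ((aeval F) G) = aeval (fun i => aeval q (F i)) G := by
      rw [← AlgHom.comp_apply, comp_aeval]
    rw [← h1, hG, map_zero]

/-- A matrix with linearly independent rows has a nonvanishing maximal minor. -/
theorem Matrix.exists_det_submatrix_ne_zero {κ β : Type} [Fintype κ] [DecidableEq κ] [Fintype β]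
    (M : Matrix κ β ℝ) (h : ∀ c : κ → ℝ, (∀ i, ∑ k, c k * M k i = 0) → c = 0) :
    ∃ J : κ → β, Function.Injective J ∧ (M.submatrix id J).det ≠ 0 := by
  classical
  -- A functional that kills all columns is a linear relation among the rows. So the columns span,
  -- and a basis chosen among them gives the minor.
  have hspan : Submodule.span ℝ (Set.range fun i k => M k i) = ⊤ := by
    by_contra hne
    obtain ⟨f, hf0, hf⟩ := Submodule.exists_le_ker_of_lt_top _ (lt_top_iff_ne_top.mpr hne)
    apply hf0
    have hc := h (fun k => f fun j => if k = j then 1 else 0) fun i => by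
      have : f (fun k => M k i) = 0 := hf (Submodule.subset_span ⟨i, rfl⟩)
      rw [LinearMap.pi_apply_eq_sum_univ] at this
      simpa only [smul_eq_mul, mul_comm] using this
    refine LinearMap.ext fun x => ?_
    rw [LinearMap.pi_apply_eq_sum_univ]
    exact Finset.sum_eq_zero fun k _ => by rw [congrFun hc k]; simp
  obtain ⟨κ', a, ha, hsp, hli⟩ := exists_linearIndependent' ℝ (fun i k => M k i)
  let b := Module.Basis.mk hli (by rw [hsp, hspan])
  have : Fintype κ' := Fintype.ofInjective a ha
  have hc : Fintype.card κ = Fintype.card κ' := by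
    rw [← Module.finrank_eq_card_basis b, Module.finrank_fintype_fun_eq_card]
  let e : κ ≃ κ' := Fintype.equivOfCardEq hc
  refine ⟨a ∘ e, ha.comp e.injective, ?_⟩
  have hli' : LinearIndependent ℝ (fun k => (M.submatrix id (a ∘ e)).col k) :=
    hli.comp e e.injective
  have := Matrix.linearIndependent_cols_iff_isUnit.mp hli'
  exact ((Matrix.isUnit_iff_isUnit_det _).mp this).ne_zero

open MvPolynomial in
/-- Coordinate version of dimension-count elimination. -/
theorem exists_polynomial_of_linear_conditions {ι κ β : Type} [Fintype ι] [Fintype κ] [Fintype β]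
    (hcard : Fintype.card ι ≤ Fintype.card κ) (M : Matrix κ β (MvPolynomial ι ℝ))
    {R : MvPolynomial ι ℝ} (hR : R ≠ 0) :
    ∃ G : MvPolynomial β ℝ, G ≠ 0 ∧ ∀ (p : ι → ℝ) (x : β → ℝ), aeval p R = 0 →
      (∀ k, ∑ i, aeval p (M k i) * x i = 0) →
      (∀ c : κ → ℝ, (∀ i, ∑ k, c k * aeval p (M k i) = 0) → c = 0) → aeval x G = 0 := by
  classical
  -- For fixed columns `J` with nonzero minor, the solutions `x` are parametrized by `p` and the
  -- coordinates outside `J`: at most as many parameters as `x` has coordinates, so restricting to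
  -- `R = 0` forces a relation.
  have main : ∀ J : κ → β, ∃ G : MvPolynomial β ℝ, G ≠ 0 ∧ ∀ (p : ι → ℝ) (x : β → ℝ),
      Function.Injective J → aeval p R = 0 → (∀ k, ∑ i, aeval p (M k i) * x i = 0) →
      aeval p (M.submatrix id J).det ≠ 0 → aeval x G = 0 := by
    intro J
    by_cases hJ : Function.Injective J
    swap
    · exact ⟨1, one_ne_zero, fun _ _ h => absurd h hJ⟩
    let C := {i : β // i ∉ Set.range J}
    let inl : MvPolynomial ι ℝ →ₐ[ℝ] MvPolynomial (ι ⊕ C) ℝ := rename Sum.inl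
    let N := M.submatrix id J
    -- Cramer's rule. The free coordinates are rescaled by the minor, which clears the denominators
    -- and makes the parametrization polynomial.
    let F : β → MvPolynomial (ι ⊕ C) ℝ := fun i =>
      if h : i ∈ Set.range J then
        -∑ l, inl (N.adjugate h.choose l) * ∑ i' : C, inl (M l i') * X (Sum.inr i')
      else inl N.det * X (Sum.inr ⟨i, h⟩)
    have hcardτ : Fintype.card (ι ⊕ C) ≤ Fintype.card β := by
      have h1 : Fintype.card C = Fintype.card β - Fintype.card κ := by
        have := Fintype.card_compl_set (Set.range J)
        rw [Set.card_range_of_injective hJ] at this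
        exact this
      have h2 := Fintype.card_le_of_injective J hJ
      rw [Fintype.card_sum, h1]
      omega
    have hR' : inl R ≠ 0 := by
      simpa [inl] using (rename_injective _ Sum.inl_injective).ne hR
    obtain ⟨G, hG0, hG⟩ := MvPolynomial.exists_relation_on_zeroLocus hcardτ F hR'
    refine ⟨G, hG0, fun p x _ hp hx hdet => ?_⟩
    set Δ := aeval p N.det with hΔ
    let q : ι ⊕ C → ℝ := Sum.elim p (fun i => x i / Δ)
    have hinl : ∀ f, aeval q (inl f) = aeval p f := fun f => by
      simp only [inl, aeval_rename]; rfl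
    have hFx : (fun i => aeval q (F i)) = x := by
      let A : Matrix κ κ ℝ := N.map (aeval p)
      have hA : A.det = Δ := by
        simp only [A, hΔ]
        exact (AlgHom.map_det (aeval p) N).symm
      have hAdj : ∀ k l, aeval p (N.adjugate k l) = A.adjugate k l := fun k l => by
        have := (AlgHom.map_adjugate (aeval (R := ℝ) p) N)
        exact congrFun (congrFun this k) l
      have hsys : ∀ l, ∑ k, A l k * x (J k) = -∑ i' : C, aeval p (M l i') * x i' := by
        intro l
        have h := hx l
        rw [← Fintype.sum_subtype_add_sum_subtype (fun i => i ∈ Set.range J)] at h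
        have h2 : ∑ i : {i // i ∈ Set.range J}, aeval p (M l i) * x i = ∑ k, A l k * x (J k) := by
          rw [← (Equiv.ofInjective J hJ).sum_comp]
          rfl
        rw [← h2]
        convert eq_neg_of_add_eq_zero_left h
      ext i
      by_cases h : i ∈ Set.range J
      · simp only [F, dif_pos h, map_neg, map_sum, map_mul, hinl, hAdj, aeval_X]
        have hk := h.choose_spec
        set k := h.choose
        have e1 : ∀ l, ∑ i' : C, aeval p (M l i') * q (Sum.inr i')
            = -(∑ k', A l k' * x (J k')) / Δ := by
          intro l
          rw [hsys, neg_neg, Finset.sum_div]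
          refine Finset.sum_congr rfl fun i' _ => ?_
          simp only [q, Sum.elim_inr]; ring
        simp only [e1]
        have e2 : A.adjugate.mulVec (A.mulVec (fun k' => x (J k'))) k = Δ * x (J k) := by
          rw [Matrix.mulVec_mulVec, Matrix.adjugate_mul, hA, Matrix.smul_mulVec, Matrix.one_mulVec]
          rfl
        rw [← hk, ← mul_right_inj' hdet, ← e2]
        simp only [Matrix.mulVec, dotProduct]
        rw [← Finset.sum_neg_distrib, Finset.mul_sum]
        refine Finset.sum_congr rfl fun l _ => ?_
        field_simp
      · simp only [F, dif_neg h, map_mul, hinl, aeval_X, q, Sum.elim_inr, ← hΔ]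
        field_simp
    have := hG q (by rw [hinl, hp])
    rwa [hFx] at this
  choose G hG0 hG using main
  refine ⟨∏ J, G J, Finset.prod_ne_zero_iff.mpr fun J _ => hG0 J, fun p x hp hx hind => ?_⟩
  obtain ⟨J, hJ, hdet⟩ := Matrix.exists_det_submatrix_ne_zero (M.map (aeval p)) hind
  rw [map_prod]
  refine Finset.prod_eq_zero (Finset.mem_univ J) (hG J p x hJ hp hx ?_)
  have := (AlgHom.map_det (aeval (R := ℝ) p) (M.submatrix id J))
  rw [this]
  exact hdet

/-! ### Zariski-generic elements of a linear subspace -/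

open MvPolynomial in
/-- The restriction of a polynomial function to a line is a polynomial function. -/
theorem exists_polynomial_eval_line {σ : Type*} (P : MvPolynomial σ ℝ) (T D : σ → ℝ) :
    ∃ Q : Polynomial ℝ, ∀ t : ℝ, Polynomial.eval t Q = eval (T + t • D) P := by
  refine ⟨aeval (fun i => Polynomial.C (T i) + Polynomial.X * Polynomial.C (D i)) P, fun t => ?_⟩
  rw [← Polynomial.coe_aeval_eq_eval, ← AlgHom.comp_apply, comp_aeval, ← coe_aeval_eq_eval,
    RingHom.coe_coe]
  congr 2
  funext i
  simp only [map_add, map_mul, Polynomial.aeval_C, Polynomial.aeval_X, Pi.add_apply, Pi.smul_apply,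
    smul_eq_mul, Algebra.algebraMap_self, RingHom.id_apply]

open MvPolynomial in
/-- The filter of properties that hold on a nonempty Zariski-open subset of a linear subspace of
`σ → ℝ`. -/
def zariskiGeneric {σ : Type} [Fintype σ] (W : Submodule ℝ (σ → ℝ)) : Filter (σ → ℝ) where
  sets := {S | ∃ P : MvPolynomial σ ℝ, (∃ T ∈ W, eval T P ≠ 0) ∧
    ∀ T ∈ W, eval T P ≠ 0 → T ∈ S}
  univ_sets := ⟨1, ⟨0, W.zero_mem, by simp⟩, fun _ _ _ => Set.mem_univ _⟩
  sets_of_superset := by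
    rintro S S' ⟨P, h1, h2⟩ hS
    exact ⟨P, h1, fun T hT hP => hS (h2 T hT hP)⟩
  inter_sets := by
    rintro S S' ⟨P, ⟨T, hT, hTP⟩, h2⟩ ⟨P', ⟨T', hT', hTP'⟩, h2'⟩
    -- On the line through the two witnesses both polynomials restrict to nonzero polynomials in one
    -- variable, so their product has a nonroot.
    obtain ⟨Q, hQ⟩ := exists_polynomial_eval_line P T (T' - T)
    obtain ⟨Q', hQ'⟩ := exists_polynomial_eval_line P' T (T' - T)
    have hne : Q * Q' ≠ 0 := by
      refine mul_ne_zero ?_ ?_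
      · rintro rfl
        exact hTP (by simpa using (hQ 0).symm)
      · rintro rfl
        exact hTP' (by simpa using (hQ' 1).symm)
    obtain ⟨t, ht⟩ : ∃ t : ℝ, Polynomial.eval t (Q * Q') ≠ 0 := by
      by_contra! h
      exact hne (Polynomial.funext (by simpa using h))
    rw [Polynomial.eval_mul, hQ, hQ', ← map_mul] at ht
    refine ⟨P * P', ⟨_, W.add_mem hT (W.smul_mem t (W.sub_mem hT' hT)), ht⟩, fun T hT h => ?_⟩
    rw [map_mul] at h
    exact ⟨h2 T hT (left_ne_zero_of_mul h), h2' T hT (right_ne_zero_of_mul h)⟩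

open MvPolynomial in
/-- Elimination by counting dimensions: a generic element of `W` does not satisfy, for any parameter
on the hypersurface `R = 0`, a family of independent linear conditions that has as many members as
there are parameters. -/
theorem eventually_not_linear_conditions {σ ι κ : Type} [Fintype σ] [Fintype ι] [Fintype κ]
    (W : Submodule ℝ (σ → ℝ)) (hcard : Fintype.card ι ≤ Fintype.card κ)
    (Φ : κ → (σ → ℝ) →ₗ[ℝ] MvPolynomial ι ℝ) {R : MvPolynomial ι ℝ} (hR : R ≠ 0) :
    ∀ᶠ T in zariskiGeneric W, ∀ p : ι → ℝ, aeval p R = 0 → (∀ k, aeval p (Φ k T) = 0) →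
      ¬ ∀ c : κ → ℝ, (∀ S ∈ W, ∑ k, c k * aeval p (Φ k S) = 0) → c = 0 := by
  classical
  let b := Module.finBasis ℝ W
  obtain ⟨G, hG0, hG⟩ := exists_polynomial_of_linear_conditions hcard
    (Matrix.of fun k i => Φ k (b i : σ → ℝ)) hR
  -- A retraction onto `W` makes the coordinates of `W` linear polynomials `ℓ` in the ambient
  -- entries, through which `G` is pulled back.
  obtain ⟨f, hf⟩ : ∃ f : (σ → ℝ) →ₗ[ℝ] W, ∀ w : W, f w = w :=
    let ⟨f, hf⟩ := W.subtype.exists_leftInverse_of_injective (by simp)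
    ⟨f, fun w => LinearMap.congr_fun hf w⟩
  let ℓ : Fin (Module.finrank ℝ W) → MvPolynomial σ ℝ := fun i =>
    ∑ s, C (b.repr (f fun j => if s = j then 1 else 0) i) * X s
  have hℓ : ∀ (w : W) i, eval (w : σ → ℝ) (ℓ i) = b.repr w i := by
    intro w i
    conv_rhs => rw [← hf w]
    have := LinearMap.pi_apply_eq_sum_univ ((b.coord i) ∘ₗ f) (w : σ → ℝ)
    simp only [LinearMap.comp_apply, Module.Basis.coord_apply] at this
    rw [this]
    simp [ℓ, mul_comm]
  have hev : ∀ w : W, eval (w : σ → ℝ) (aeval ℓ G) = aeval (b.repr w) G := by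
    intro w
    rw [← coe_aeval_eq_eval, RingHom.coe_coe, ← AlgHom.comp_apply, comp_aeval]
    congr 2
    funext i
    rw [← hℓ w i, ← coe_aeval_eq_eval, RingHom.coe_coe]
  refine ⟨aeval ℓ G, ?_, fun T hT hP p hp hΦ hind => hP ?_⟩
  · obtain ⟨x, hx⟩ : ∃ x, eval x G ≠ 0 := by
      by_contra! h
      exact hG0 (MvPolynomial.funext (by simpa using h))
    refine ⟨_, (b.equivFun.symm x).2, ?_⟩
    rw [hev]
    have : ⇑(b.repr (b.equivFun.symm x)) = x := b.equivFun.apply_symm_apply x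
    rw [this]
    exact hx
  · have := hev ⟨T, hT⟩
    simp only at this
    rw [this]
    refine hG p _ hp (fun k => ?_) (fun c hc => hind c fun S hS => ?_)
    · rw [← hΦ k]
      have hT' : T = ∑ i, b.repr ⟨T, hT⟩ i • (b i : σ → ℝ) := by
        have := congrArg W.subtype (b.sum_repr ⟨T, hT⟩)
        rw [map_sum] at this
        exact this.symm
      conv_rhs => rw [hT']
      simp [mul_comm]
    · have hS' : S = ∑ i, b.repr ⟨S, hS⟩ i • (b i : σ → ℝ) := by
        have := congrArg W.subtype (b.sum_repr ⟨S, hS⟩)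
        rw [map_sum] at this
        exact this.symm
      rw [hS']
      simp only [map_sum, map_smul, Finset.mul_sum, smul_eq_mul]
      rw [Finset.sum_comm]
      refine Finset.sum_eq_zero fun i _ => ?_
      have := hc i
      simp only [Matrix.of_apply] at this
      rw [← mul_zero (b.repr ⟨S, hS⟩ i), ← this, Finset.mul_sum]
      exact Finset.sum_congr rfl fun k _ => by ring

/-! ### Contractions of symmetric tensors -/

section Contraction

variable {n e : ℕ} {S S' : Type*} [CommRing S] [Algebra ℝ S] [CommRing S'] [Algebra ℝ S']

/-- The contraction `T(w, u, …, u)` of a tensor of order `e + 1`, as a linear map in `T`. -/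
noncomputable def contract (u w : Fin n → S) : ((Fin (e + 1) → Fin n) → ℝ) →ₗ[ℝ] S where
  toFun T := ∑ idx, T idx • (w (idx 0) * ∏ k : Fin e, u (idx k.succ))
  map_add' T T' := by simp [add_smul, Finset.sum_add_distrib]
  map_smul' c T := by simp [Finset.smul_sum, mul_smul]

theorem contract_apply (u w : Fin n → S) (T : (Fin (e + 1) → Fin n) → ℝ) :
    contract u w T = ∑ idx, T idx • (w (idx 0) * ∏ k : Fin e, u (idx k.succ)) := rfl

theorem map_contract (f : S →ₐ[ℝ] S') (u w : Fin n → S) (T : (Fin (e + 1) → Fin n) → ℝ) :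
    f (contract u w T) = contract (fun j => f (u j)) (fun j => f (w j)) T := by
  simp [contract_apply, map_sum, map_prod]

theorem contract_sum_right {κ : Type*} [Fintype κ] (u : Fin n → ℝ) (c : κ → ℝ)
    (w : κ → Fin n → ℝ) (T : (Fin (e + 1) → Fin n) → ℝ) :
    contract u (fun j => ∑ k, c k * w k j) T = ∑ k, c k * contract u (w k) T := by
  simp only [contract_apply, smul_eq_mul, Finset.mul_sum, Finset.sum_mul]
  rw [Finset.sum_comm]
  exact Finset.sum_congr rfl fun _ _ => Finset.sum_congr rfl fun _ _ => by ring

theorem contract_smul_left (u w : Fin n → ℝ) (s : ℝ) (T : (Fin (e + 1) → Fin n) → ℝ) :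
    contract (s • u) w T = s ^ e * contract u w T := by
  simp only [contract_apply, smul_eq_mul, Finset.mul_sum, Pi.smul_apply, Finset.prod_mul_distrib,
    Finset.prod_const, Finset.card_univ, Fintype.card_fin]
  exact Finset.sum_congr rfl fun _ _ => by ring

/-- The symmetric tensor with entries `L (g i₁ * ⋯ * g i_d)`. -/
noncomputable def productTensor {A : Type*} [CommRing A] [Algebra ℝ A] (d : ℕ) (g : Fin n → A) (L : A →ₗ[ℝ] ℝ) :
    (Fin d → Fin n) → ℝ :=
  fun idx => L (∏ k, g (idx k))

/-- Contracting a product tensor substitutes linear combinations of `g` into `L`. Contractions of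
the test tensors below thus become coefficient extractions in a polynomial ring. -/
theorem contract_productTensor {A : Type*} [CommRing A] [Algebra ℝ A] (g : Fin n → A)
    (L : A →ₗ[ℝ] ℝ) (u w : Fin n → ℝ) :
    contract u w (productTensor (e + 1) g L) = L ((∑ j, w j • g j) * (∑ j, u j • g j) ^ e) := by
  have h1 : (∑ j, u j • g j) ^ e = ∑ f : Fin e → Fin n, ∏ k, u (f k) • g (f k) := by
    rw [← Fin.prod_const, Fintype.prod_sum]
  rw [h1, Finset.sum_mul_sum, map_sum, contract_apply,
    ← (Fin.consEquiv fun _ : Fin (e + 1) => Fin n).sum_comp, Fintype.sum_prod_type]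
  refine Finset.sum_congr rfl fun j _ => ?_
  rw [map_sum]
  refine Finset.sum_congr rfl fun f _ => ?_
  simp only [productTensor, Fin.consEquiv, Equiv.coe_fn_mk, Fin.prod_univ_succ, Fin.cons_zero,
    Fin.cons_succ, smul_eq_mul]
  have h2 : w j • g j * ∏ k, u (f k) • g (f k)
      = (w j * ∏ k, u (f k)) • (g j * ∏ k, g (f k)) := by
    rw [show ∏ k, u (f k) • g (f k) = (∏ k, u (f k)) • ∏ k, g (f k) from Finset.prod_smul ..]
    rw [smul_mul_smul_comm]
  rw [h2, map_smul, smul_eq_mul, mul_comm]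

/-- `Vpmi d n` as a linear subspace. -/
def VpmiSubmodule (d n : ℕ) : Submodule ℝ ((Fin d → Fin n) → ℝ) where
  carrier := Vpmi d n
  zero_mem' := ⟨fun _ _ => rfl, fun _ _ _ _ => rfl⟩
  add_mem' h h' := ⟨fun σ idx => by simp [h.1 σ idx, h'.1 σ idx],
    fun k i j hij => by simp [h.2 k i j hij, h'.2 k i j hij]⟩
  smul_mem' c T h := ⟨fun σ idx => by simp [h.1 σ idx], fun k i j hij => by simp [h.2 k i j hij]⟩

theorem productTensor_mem {A : Type*} [CommRing A] [Algebra ℝ A] (g : Fin n → A) (L : A →ₗ[ℝ] ℝ)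
    (h : ∀ i j, i ≠ j → L (g i * g j ^ e) = 0) :
    productTensor (e + 1) g L ∈ VpmiSubmodule (e + 1) n := by
  refine ⟨fun σ idx => ?_, fun k i j hij => ?_⟩
  · simp only [productTensor, Function.comp]
    rw [Equiv.prod_comp σ fun k => g (idx k)]
  · simp only [productTensor]
    rw [← h i j hij, ← Finset.mul_prod_erase _ _ (Finset.mem_univ k), Function.update_self]
    congr 2
    rw [Finset.prod_congr rfl (g := fun _ => g j), Finset.prod_const, Finset.card_erase_of_mem
      (Finset.mem_univ k), Finset.card_univ, Fintype.card_fin, Nat.add_sub_cancel]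
    intro l hl
    rw [Function.update_of_ne (Finset.ne_of_mem_erase hl)]

end Contraction

/-! ### Monomial test tensors in `Vpmi` -/

section TestTensors

variable {n e : ℕ}

theorem sum_smul_add_single {A : Type*} [CommRing A] [Algebra ℝ A] (u : Fin n → ℝ) (a : Fin n)
    (x : A) (g : Fin n → A) :
    ∑ j, u j • (Pi.single a x + g : Fin n → A) j = u a • x + ∑ j, u j • g j := by
  simp only [Pi.add_apply, smul_add, Finset.sum_add_distrib]
  congr 1
  rw [Finset.sum_eq_single a] <;> simp +contextual

open Polynomial in
theorem coeff_C_add_C_mul_X_pow (x y : ℝ) (e k : ℕ) :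
    ((C x + C y * X) ^ e).coeff k = e.choose k * x ^ (e - k) * y ^ k := by
  rw [add_comm (C x), add_pow, finsetSum_coeff]
  have : ∀ m, ((C y * X) ^ m * C x ^ (e - m) * (e.choose m : ℝ[X])).coeff k
      = if k = m then e.choose m * x ^ (e - m) * y ^ m else 0 := by
    intro m
    have : (C y * X) ^ m * C x ^ (e - m) * (e.choose m : ℝ[X])
        = C (e.choose m * x ^ (e - m) * y ^ m) * X ^ m := by
      simp only [map_mul, map_pow, map_natCast]; ring
    rw [this, coeff_C_mul_X_pow]
  simp only [this, Finset.sum_ite_eq, Finset.mem_range]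
  split_ifs with h
  · rfl
  · rw [Nat.choose_eq_zero_of_lt (by omega)]; simp

/-- The tensor `e_j ⊗ ⋯ ⊗ e_j`. -/
noncomputable def diagTensor (e : ℕ) (j : Fin n) : (Fin (e + 1) → Fin n) → ℝ :=
  -- The summand `0` gives the shape to which `sum_smul_add_single` applies.
  productTensor (e + 1) (Pi.single j (1 : ℝ) + 0) LinearMap.id

theorem diagTensor_mem (he : e ≠ 0) (j : Fin n) : diagTensor e j ∈ VpmiSubmodule (e + 1) n := by
  refine productTensor_mem _ _ fun i k hik => ?_
  by_cases h : k = j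
  · subst h; simp [hik]
  · simp [h, he]

theorem contract_diagTensor (u w : Fin n → ℝ) (j : Fin n) :
    contract u w (diagTensor e j) = w j * u j ^ e := by
  rw [diagTensor, contract_productTensor]
  simp only [sum_smul_add_single]
  simp

open Polynomial in
/-- The symmetric tensor of the monomial with two factors `b` and `e - 1` factors `a`. -/
noncomputable def twoTensor (e : ℕ) (a b : Fin n) : (Fin (e + 1) → Fin n) → ℝ :=
  productTensor (e + 1) (Pi.single a (1 : ℝ[X]) + (Pi.single b X + 0)) (lcoeff ℝ 2)

-- The entries to be excluded read off the coefficient of `X ^ 2` in `X` or in `X ^ e`. At `e = 2`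
-- the latter survives, which is why order three needs a separate argument.
open Polynomial in
theorem twoTensor_mem (he : 3 ≤ e) {a b : Fin n} (hab : a ≠ b) :
    twoTensor e a b ∈ VpmiSubmodule (e + 1) n := by
  refine productTensor_mem _ _ fun i j hij => ?_
  have h0 : e ≠ 0 := by omega
  have h2 : ¬ 2 = e := by omega
  have h3 : ¬ 2 = e + 1 := by omega
  by_cases ha : j = a
  · subst ha
    by_cases hb : i = b
    · subst hb; simp [hij, hij.symm, coeff_X]
    · simp [hij, hb]
  · by_cases hb : j = b
    · subst hb
      by_cases hi : i = a
      · subst hi; simp [hij, hij.symm, coeff_X_pow, h2]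
      · simp [hij, hi]
    · simp [ha, hb, h0]

open Polynomial in
theorem contract_twoTensor (u w : Fin n → ℝ) (a b : Fin n) :
    contract u w (twoTensor e a b) = e.choose 2 * w a * u a ^ (e - 2) * u b ^ 2
      + e * w b * u a ^ (e - 1) * u b := by
  rw [twoTensor, contract_productTensor]
  simp only [sum_smul_add_single]
  have : (w a • (1 : ℝ[X]) + (w b • X + ∑ j, w j • (0 : Fin n → ℝ[X]) j))
      * (u a • (1 : ℝ[X]) + (u b • X + ∑ j, u j • (0 : Fin n → ℝ[X]) j)) ^ e
      = C (w a) * (C (u a) + C (u b) * X) ^ e + C (w b) * ((C (u a) + C (u b) * X) ^ e * X) := by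
    simp only [Pi.zero_apply, smul_zero, Finset.sum_const_zero, add_zero, smul_eq_C_mul, mul_one]
    ring
  rw [this, lcoeff_apply, coeff_add, coeff_C_mul, coeff_C_mul, coeff_C_add_C_mul_X_pow,
    coeff_mul_X, coeff_C_add_C_mul_X_pow]
  simp
  ring

open Polynomial in
/-- The coefficient of `X Y` in `ℝ[X][Y]`. -/
noncomputable def coeffXY : ℝ[X][X] →ₗ[ℝ] ℝ :=
  (lcoeff ℝ 1) ∘ₗ ((lcoeff ℝ[X] 1).restrictScalars ℝ)

open Polynomial in
theorem coeffXY_apply (p : ℝ[X][X]) : coeffXY p = (p.coeff 1).coeff 1 := rfl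

open Polynomial in
/-- The symmetric tensor of the monomial with one factor `b`, one factor `c` and `e - 1`
factors `a`. -/
noncomputable def threeTensor (e : ℕ) (a b c : Fin n) : (Fin (e + 1) → Fin n) → ℝ :=
  productTensor (e + 1) (Pi.single a (1 : ℝ[X][X]) + (Pi.single b (C X) + (Pi.single c X + 0)))
    coeffXY

-- Entries `i j ⋯ j` see at most two indices, while the monomial has three distinct ones; `e ≥ 2`
-- guarantees that `a` really occurs.
open Polynomial in
theorem threeTensor_mem (he : 2 ≤ e) {a b c : Fin n} (hab : a ≠ b) (hac : a ≠ c) (hbc : b ≠ c) :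
    threeTensor e a b c ∈ VpmiSubmodule (e + 1) n := by
  refine productTensor_mem _ _ fun i j hij => ?_
  have h0 : e ≠ 0 := by omega
  have h2 : ¬ 1 = e := by omega
  have h3 : ¬ 0 = e := by omega
  have hC : ∀ k, (C X : ℝ[X][X]) ^ k = C (X ^ k) := fun k => by simp
  have hgi : (Pi.single a (1 : ℝ[X][X]) + (Pi.single b (C X) + (Pi.single c X + 0)) :
      Fin n → ℝ[X][X]) i = if i = a then 1 else if i = b then C X else if i = c then X else 0 := by
    split_ifs <;> simp_all
  have hgj : (Pi.single a (1 : ℝ[X][X]) + (Pi.single b (C X) + (Pi.single c X + 0)) :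
      Fin n → ℝ[X][X]) j = if j = a then 1 else if j = b then C X else if j = c then X else 0 := by
    split_ifs <;> simp_all
  rw [hgi, hgj, coeffXY_apply]
  split_ifs <;> first
    | (exfalso; subst_vars; exact hij rfl)
    | (try simp only [hC]); simp [-map_pow, coeff_X_pow, coeff_one, coeff_C, h0, h2]

-- When `u c = 0`, only terms with `w` in the slot `c` survive, so this tensor isolates the
-- coordinate `w c`.
open Polynomial in
theorem contract_threeTensor {u : Fin n → ℝ} (w : Fin n → ℝ) (a b : Fin n) {c : Fin n}
    (hc : u c = 0) :
    contract u w (threeTensor e a b c) = e * u a ^ (e - 1) * u b * w c := by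
  rw [threeTensor, contract_productTensor]
  simp only [sum_smul_add_single]
  have hs : ∀ (r : ℝ) (p : ℝ[X][X]), r • p = C (C r) * p := fun r p => by
    rw [Algebra.smul_def]; rfl
  have : (w a • (1 : ℝ[X][X]) + (w b • C X + (w c • X + ∑ j, w j • (0 : Fin n → ℝ[X][X]) j)))
      * (u a • (1 : ℝ[X][X]) + (u b • C X + (u c • X + ∑ j, u j • (0 : Fin n → ℝ[X][X]) j))) ^ e
      = C ((C (w a) + C (w b) * X) * (C (u a) + C (u b) * X) ^ e)
        + C (C (w c) * (C (u a) + C (u b) * X) ^ e) * X := by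
    simp only [Pi.zero_apply, smul_zero, Finset.sum_const_zero, add_zero]
    simp only [hs, hc, mul_one, map_mul, map_add, map_pow, map_zero, zero_mul, add_zero]
    ring
  rw [this, coeffXY_apply, coeff_add, coeff_C, coeff_C_mul, coeff_X_one, if_neg one_ne_zero,
    zero_add, mul_one, coeff_C_mul, coeff_C_add_C_mul_X_pow]
  simp
  ring

end TestTensors

/-! ### Independence of the eigenvector equations on `Vpmi` -/

section Independence

variable {n e : ℕ}

/-- On `Vpmi`, the functionals `T ↦ T(w, u, …, u)` are independent in `w` when `u` has two nonzero
coordinates. -/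
theorem eq_zero_of_contract_eq_zero (he : 2 ≤ e) {u w : Fin n → ℝ} {a b : Fin n} (hab : a ≠ b)
    (ha : u a ≠ 0) (hb : u b ≠ 0)
    (h : ∀ S ∈ VpmiSubmodule (e + 1) n, contract u w S = 0) : w = 0 := by
  ext c
  by_cases hc : u c = 0
  · have hac : a ≠ c := by rintro rfl; exact ha hc
    have hbc : b ≠ c := by rintro rfl; exact hb hc
    have := h _ (threeTensor_mem he hab hac hbc)
    rw [contract_threeTensor w a b hc] at this
    have h0 : (e : ℝ) ≠ 0 := by positivity
    simpa [ha, hb, h0] using this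
  · have := h _ (diagTensor_mem (by omega) c)
    rw [contract_diagTensor] at this
    simpa [hc] using this

/-- The difference of the two sides at `m + 2` is `(x y) ^ 2` times the difference at `m` plus a
positive product; at `m = 0` there is equality. The variables stand for square roots, which avoids
half-integer exponents. -/
theorem mul_pow_mul_lt_two_mul_sub_pow (m : ℕ) {x y : ℝ} (hy : 0 < y) (hxy : y < x) :
    (m + 2) * (x * y) ^ m * (x ^ 4 - y ^ 4) ≤ 2 * (x ^ (2 * (m + 2)) - y ^ (2 * (m + 2))) ∧
    (m ≠ 0 →
      (m + 2) * (x * y) ^ m * (x ^ 4 - y ^ 4) < 2 * (x ^ (2 * (m + 2)) - y ^ (2 * (m + 2)))) := by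
  have hx : 0 < x := hy.trans hxy
  induction m using Nat.twoStepInduction with
  | zero => exact ⟨le_of_eq (by ring), fun h => absurd rfl h⟩
  | one =>
    have h1 : 0 < x ^ 2 - y ^ 2 := by nlinarith
    have h2 : 0 < (x - y) ^ 2 := by
      have := sub_pos.mpr hxy
      positivity
    have h3 : 0 < x * y := mul_pos hx hy
    have : 0 < (x ^ 2 - y ^ 2) * ((x - y) ^ 2 * (2 * x ^ 2 + x * y + 2 * y ^ 2)) := by positivity
    have key : ((1 : ℕ) + 2) * (x * y) ^ 1 * (x ^ 4 - y ^ 4)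
        < 2 * (x ^ (2 * (1 + 2)) - y ^ (2 * (1 + 2))) := by
      push_cast
      nlinarith
    exact ⟨key.le, fun _ => key⟩
  | more m ih _ =>
    have h1 : 0 < x ^ 2 - y ^ 2 := by nlinarith
    have h2 : 0 < x ^ (m + 4) - y ^ (m + 4) := sub_pos.mpr (pow_lt_pow_left₀ hxy hy.le (by omega))
    have h3 : 0 < x ^ (m + 2) - y ^ (m + 2) := sub_pos.mpr (pow_lt_pow_left₀ hxy hy.le (by omega))
    have h4 := mul_pos h1 (mul_pos h2 h3)
    have h5 := mul_le_mul_of_nonneg_left ih.1 (sq_nonneg (x * y))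
    have key : ((m + 2 : ℕ) + 2) * (x * y) ^ (m + 2) * (x ^ 4 - y ^ 4)
        < 2 * (x ^ (2 * (m + 2 + 2)) - y ^ (2 * (m + 2 + 2))) := by
      have e1 : 2 * (x ^ (2 * (m + 2 + 2)) - y ^ (2 * (m + 2 + 2)))
          - ((m + 2 : ℕ) + 2) * (x * y) ^ (m + 2) * (x ^ 4 - y ^ 4)
          = (x * y) ^ 2 * (2 * (x ^ (2 * (m + 2)) - y ^ (2 * (m + 2))))
            - (x * y) ^ 2 * ((m + 2) * (x * y) ^ m * (x ^ 4 - y ^ 4))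
            + 2 * ((x ^ 2 - y ^ 2) * ((x ^ (m + 4) - y ^ (m + 4)) * (x ^ (m + 2) - y ^ (m + 2)))) := by
        push_cast; ring
      linarith
    exact ⟨key.le, fun _ => key⟩

/-- This is the sign of the determinant of the linear system in `eq_of_two_by_two_system`. -/
theorem sq_mul_pow_mul_lt_sub_pow_sq {k : ℕ} (hk : 3 ≤ k) {a b : ℝ} (ha : a ≠ 0) (hb : b ≠ 0)
    (hab : a ^ 2 ≠ b ^ 2) :
    (k / 2 : ℝ) ^ 2 * (a * b) ^ (k - 2) * (a ^ 2 - b ^ 2) ^ 2 < (a ^ k - b ^ k) ^ 2 := by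
  wlog hlt : |b| < |a| generalizing a b with H
  · have hne : |a| ≠ |b| := fun h => hab (sq_eq_sq_iff_abs_eq_abs a b |>.mpr h)
    have := H hb ha hab.symm (lt_of_le_of_ne (not_lt.mp hlt) hne)
    rw [mul_comm b a] at this
    convert this using 1 <;> ring
  obtain ⟨m, rfl⟩ : ∃ m, k = m + 2 := ⟨k - 2, by omega⟩
  have hbp : 0 < |b| := abs_pos.mpr hb
  have hap : 0 < |a| := abs_pos.mpr ha
  have key := (mul_pow_mul_lt_two_mul_sub_pow m (x := √|a|) (y := √|b|) (Real.sqrt_pos.mpr hbp)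
    (Real.sqrt_lt_sqrt hbp.le hlt)).2 (by omega)
  have e4 : ∀ x : ℝ, √|x| ^ 4 = x ^ 2 := fun x => by
    rw [show 4 = 2 * 2 from rfl, pow_mul, Real.sq_sqrt (abs_nonneg x), sq_abs]
  simp only [pow_mul _ 2, Real.sq_sqrt (abs_nonneg _), e4] at key
  have hΔ : 0 < a ^ 2 - b ^ 2 := sub_pos.mpr (sq_lt_sq.mpr hlt)
  have h1 : (√|a| * √|b|) ^ 2 = |a * b| := by
    rw [mul_pow, Real.sq_sqrt hap.le, Real.sq_sqrt hbp.le, abs_mul]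
  have h2 : ((m + 2) * (√|a| * √|b|) ^ m * (a ^ 2 - b ^ 2)) ^ 2
      < (2 * (|a| ^ (m + 2) - |b| ^ (m + 2))) ^ 2 :=
    pow_lt_pow_left₀ key (by positivity) two_ne_zero
  have h3 : ((m + 2) * (√|a| * √|b|) ^ m * (a ^ 2 - b ^ 2)) ^ 2
      = ((m + 2 : ℝ)) ^ 2 * |a * b| ^ m * (a ^ 2 - b ^ 2) ^ 2 := by
    rw [← h1]; ring
  have h4 : (|a| ^ (m + 2) - |b| ^ (m + 2)) ^ 2 ≤ (a ^ (m + 2) - b ^ (m + 2)) ^ 2 := by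
    rw [← abs_pow, ← abs_pow]
    exact sq_le_sq.mpr (abs_abs_sub_abs_le _ _)
  have h5 : (a * b) ^ m ≤ |a * b| ^ m := by
    rw [← abs_pow]; exact le_abs_self _
  have h6 : ((m + 2 : ℝ)) ^ 2 * (a * b) ^ m * (a ^ 2 - b ^ 2) ^ 2
      ≤ ((m + 2 : ℝ)) ^ 2 * |a * b| ^ m * (a ^ 2 - b ^ 2) ^ 2 := by gcongr
  rw [h3] at h2
  rw [Nat.add_sub_cancel]
  push_cast
  nlinarith

/-- For `k ≥ 3` the determinant is nonzero and both unknowns vanish. For `k = 2` the system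
degenerates to `x = y`, which is all that can be claimed uniformly. -/
theorem eq_of_two_by_two_system {k : ℕ} (hk : 2 ≤ k) {a b x y : ℝ} (ha : a ≠ 0) (hb : b ≠ 0)
    (hab : a ^ 2 ≠ b ^ 2)
    (h1 : (k / 2 : ℝ) * x * a ^ (k - 2) * (a ^ 2 - b ^ 2) = y * (a ^ k - b ^ k))
    (h2 : (k / 2 : ℝ) * y * b ^ (k - 2) * (a ^ 2 - b ^ 2) = x * (a ^ k - b ^ k)) : x = y := by
  have hΔ : a ^ 2 - b ^ 2 ≠ 0 := sub_ne_zero.mpr hab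
  rcases hk.eq_or_lt with rfl | hk3
  · simp at h1
    tauto
  · have hlt := sq_mul_pow_mul_lt_sub_pow_sq hk3 ha hb hab
    have hk0 : (k : ℝ) ≠ 0 := by positivity
    have hprod : x * y * ((a ^ k - b ^ k) ^ 2
        - (k / 2 : ℝ) ^ 2 * (a * b) ^ (k - 2) * (a ^ 2 - b ^ 2) ^ 2) = 0 := by
      rw [mul_pow]
      linear_combination -((k / 2 : ℝ) * x * a ^ (k - 2) * (a ^ 2 - b ^ 2)) * h2
        - x * (a ^ k - b ^ k) * h1
    rcases mul_eq_zero.mp ((mul_eq_zero.mp hprod).resolve_right (sub_pos.mpr hlt).ne') with h | h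
    · subst h
      have : (k / 2 : ℝ) * y * b ^ (k - 2) * (a ^ 2 - b ^ 2) = 0 := by rw [h2, zero_mul]
      have hy : y = 0 := by simpa [hk0, hb, hΔ] using this
      exact hy.symm
    · subst h
      have : (k / 2 : ℝ) * x * a ^ (k - 2) * (a ^ 2 - b ^ 2) = 0 := by rw [h1, zero_mul]
      simpa [hk0, ha, hΔ] using this

/-- On `Vpmi`, the functionals `T ↦ T(w, u, …, u)` and `T ↦ T(w', v, …, v)` with `w ⟂ u` and
`w' ⟂ v` are independent for orthogonal `u`, `v` in general position. -/
theorem eq_zero_of_contract_add_contract_eq_zero (he : 3 ≤ e) {u v w w' : Fin n → ℝ}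
    (hu : ∀ j, u j ≠ 0) (hv : ∀ j, v j ≠ 0) (huv : ∑ j, u j * v j = 0)
    (hsign : ∀ ε : Fin n → ℤˣ, ∑ j, ((ε j : ℤ) : ℝ) * u j ^ 2 ≠ 0)
    (hw' : ∑ j, v j * w' j = 0)
    (h : ∀ S ∈ VpmiSubmodule (e + 1) n, contract u w S + contract v w' S = 0) :
    w = 0 ∧ w' = 0 := by
  -- Dividing by the coordinates of `u` leaves the ratios `r = v / u` and `z = w' / u`; the
  -- two-index test tensors then give a system in `y = z r` alone.
  obtain ⟨r, hvr⟩ : ∃ r : Fin n → ℝ, ∀ j, v j = r j * u j :=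
    ⟨fun j => v j / u j, fun j => (div_mul_cancel₀ (v j) (hu j)).symm⟩
  obtain ⟨z, hz⟩ : ∃ z : Fin n → ℝ, ∀ j, w' j = z j * u j :=
    ⟨fun j => w' j / u j, fun j => (div_mul_cancel₀ (w' j) (hu j)).symm⟩
  have hr0 : ∀ j, r j ≠ 0 := fun j h0 => hv j (by rw [hvr j, h0, zero_mul])
  obtain ⟨y, hy⟩ : ∃ y : Fin n → ℝ, ∀ j, y j = z j * r j := ⟨_, fun _ => rfl⟩
  -- The diagonal tensors determine `w` from `w'`.
  have hdiag : ∀ j, w j = -(z j * u j * r j ^ e) := fun j => by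
    have h0 := h _ (diagTensor_mem (by omega) j)
    rw [contract_diagTensor, contract_diagTensor, hvr j, mul_pow, hz j] at h0
    have : (w j + z j * u j * r j ^ e) * u j ^ e = 0 := by linear_combination h0
    exact eq_neg_of_add_eq_zero_left ((mul_eq_zero.mp this).resolve_right (pow_ne_zero _ (hu j)))
  obtain ⟨m, rfl⟩ : ∃ m, e = m + 3 := ⟨e - 3, by omega⟩
  have hchoose : ((m + 3).choose 2 : ℝ) = (m + 3) * (m + 2) / 2 := by
    rw [Nat.cast_choose_two]; push_cast; ring
  have hpair : ∀ a b, a ≠ b →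
      (((m + 2 : ℕ) : ℝ) / 2) * y a * r a ^ (m + 2 - 2) * (r a ^ 2 - r b ^ 2)
        = y b * (r a ^ (m + 2) - r b ^ (m + 2)) := by
    intro a b hab
    have h0 := h _ (twoTensor_mem he hab)
    rw [contract_twoTensor, contract_twoTensor, hvr a, hvr b, hdiag a, hdiag b, hz a, hz b,
      hchoose] at h0
    simp only [show m + 3 - 2 = m + 1 from rfl, show m + 3 - 1 = m + 2 from rfl,
      show m + 2 - 2 = m from rfl] at h0 ⊢
    have h1 : ((m + 3 : ℕ) : ℝ) * u a ^ (m + 2) * u b ^ 2 *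
        ((((m + 2 : ℕ) : ℝ) / 2) * y a * r a ^ m * (r a ^ 2 - r b ^ 2)
          - y b * (r a ^ (m + 2) - r b ^ (m + 2))) = 0 := by
      rw [hy a, hy b]
      push_cast at h0 ⊢
      linear_combination -h0
    have h2 : ((m + 3 : ℕ) : ℝ) * u a ^ (m + 2) * u b ^ 2 ≠ 0 :=
      mul_ne_zero (mul_ne_zero (by positivity) (pow_ne_zero _ (hu a))) (pow_ne_zero _ (hu b))
    exact sub_eq_zero.mp ((mul_eq_zero.mp h1).resolve_left h2)
  have hyeq : ∀ a b, r a ^ 2 ≠ r b ^ 2 → y a = y b := by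
    intro a b hab
    have hne : a ≠ b := by rintro rfl; exact hab rfl
    refine eq_of_two_by_two_system (k := m + 2) (by omega) (hr0 a) (hr0 b) hab (hpair a b hne) ?_
    linear_combination -(hpair b a hne.symm)
  -- If all ratios agreed up to sign, orthogonality of `u` and `v` would be a vanishing signed sum
  -- of the squares of `u`.
  obtain ⟨a, b, hab⟩ : ∃ a b, r a ^ 2 ≠ r b ^ 2 := by
    by_contra! hall
    have hn : n ≠ 0 := by
      rintro rfl
      exact hsign 1 (by simp)
    have : NeZero n := ⟨hn⟩
    have hsgn : ∀ j, ∃ ε : ℤˣ, r j = ((ε : ℤ) : ℝ) * r 0 := fun j => by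
      rcases sq_eq_sq_iff_eq_or_eq_neg.mp (hall j 0) with h | h
      · exact ⟨1, by simpa using h⟩
      · exact ⟨-1, by simpa using h⟩
    choose ε hε using hsgn
    apply hsign ε
    have : r 0 * ∑ j, ((ε j : ℤ) : ℝ) * u j ^ 2 = 0 := by
      rw [← huv, Finset.mul_sum]
      refine Finset.sum_congr rfl fun j _ => ?_
      rw [hvr j, hε j]; ring
    exact (mul_eq_zero.mp this).resolve_left (hr0 0)
  -- Each `r j ^ 2` differs from that of `a` or of `b`, so any index can be linked to `a`.
  have hconst : ∀ j, y j = y a := by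
    intro j
    by_cases hj : r j ^ 2 = r a ^ 2
    · rw [hyeq a b hab, hyeq j b (hj ▸ hab)]
    · exact hyeq j a hj
  -- Since `v j * w' j = y j * u j ^ 2`, orthogonality of `w'` to `v` kills the common value.
  have hya : y a = 0 := by
    have h1 : y a * ∑ j, u j ^ 2 = 0 := by
      rw [← hw', Finset.mul_sum]
      refine Finset.sum_congr rfl fun j _ => ?_
      rw [hz j, hvr j, ← hconst j, hy j]
      ring
    refine (mul_eq_zero.mp h1).resolve_right ?_
    simpa using hsign 1
  have hz0 : ∀ j, z j = 0 := fun j => by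
    have h1 := hy j
    rw [hconst j, hya] at h1
    exact (mul_eq_zero.mp h1.symm).resolve_right (hr0 j)
  exact ⟨funext fun j => by simp [hdiag, hz0], funext fun j => by simp [hz, hz0]⟩

end Independence

/-! ### Eigenvectors of generic tensors -/

section Eigenvectors

variable {n e : ℕ}

/-- `u` is an eigenvector of `T` (or zero): the contraction `T(·, u, …, u)` is proportional
to `u`. -/
def IsTensorEigenvector (T : (Fin (e + 1) → Fin n) → ℝ) (u : Fin n → ℝ) : Prop :=
  ∀ w : Fin n → ℝ, ∑ j, u j * w j = 0 → contract u w T = 0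

theorem IsTensorEigenvector.smul {T : (Fin (e + 1) → Fin n) → ℝ} {u : Fin n → ℝ}
    (h : IsTensorEigenvector T u) {s : ℝ} (hs : s ≠ 0) : IsTensorEigenvector T (s • u) := by
  intro w hw
  rw [contract_smul_left, h w, mul_zero]
  have : s * ∑ j, u j * w j = 0 := by
    rw [← hw, Finset.mul_sum]
    exact Finset.sum_congr rfl fun j _ => by simp; ring
  exact (mul_eq_zero.mp this).resolve_left hs

/-- The equation `T(e_k - U_k e_a, U, …, U)`, linear in `T`. -/
noncomputable def eigenEquation {S : Type*} [CommRing S] [Algebra ℝ S] (U : Fin n → S)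
    (a k : Fin n) : ((Fin (e + 1) → Fin n) → ℝ) →ₗ[ℝ] S :=
  contract U fun j => if j = k then 1 else if j = a then -U k else 0

theorem map_eigenEquation {S S' : Type*} [CommRing S] [Algebra ℝ S] [CommRing S'] [Algebra ℝ S']
    (f : S →ₐ[ℝ] S') (U : Fin n → S) (a k : Fin n) (T : (Fin (e + 1) → Fin n) → ℝ) :
    f (eigenEquation U a k T) = eigenEquation (fun j => f (U j)) a k T := by
  rw [eigenEquation, map_contract, eigenEquation]
  congr 2
  funext j
  split_ifs <;> simp

theorem sum_mul_eigenEquation_vector {u : Fin n → ℝ} {a k : Fin n} (ha : u a = 1) (hk : k ≠ a) :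
    ∑ j, u j * (if j = k then 1 else if j = a then -u k else 0) = 0 := by
  rw [← Finset.add_sum_erase _ _ (Finset.mem_univ k),
    ← Finset.add_sum_erase _ _ (Finset.mem_erase.mpr ⟨hk.symm, Finset.mem_univ a⟩),
    Finset.sum_eq_zero]
  · simp [hk.symm, ha]
  · intro j hj
    simp only [Finset.mem_erase] at hj
    simp [hj.1, hj.2.1]

theorem IsTensorEigenvector.eigenEquation_eq_zero {T : (Fin (e + 1) → Fin n) → ℝ} {u : Fin n → ℝ}
    (h : IsTensorEigenvector T u) {a k : Fin n} (ha : u a = 1) (hk : k ≠ a) :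
    eigenEquation u a k T = 0 :=
  h _ (sum_mul_eigenEquation_vector ha hk)

/-- The vectors `e_k - u_k e_a` with `k ≠ a` span the hyperplane orthogonal to `u`. A relation among
the equations is therefore one contraction with a `w` in it, from which the coefficients can be read
back. -/
theorem exists_contract_eq_sum_eigenEquation {u : Fin n → ℝ} {a : Fin n} (ha : u a = 1)
    (c : {k // k ≠ a} → ℝ) : ∃ w : Fin n → ℝ, ∑ j, u j * w j = 0 ∧ (∀ k : {k // k ≠ a}, w k = c k) ∧
      ∀ S : (Fin (e + 1) → Fin n) → ℝ, ∑ k, c k * eigenEquation u a k S = contract u w S := by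
  refine ⟨fun j => ∑ k, c k * (if j = k then 1 else if j = a then -u k else 0), ?_, ?_,
    fun S => ?_⟩
  · simp only [Finset.mul_sum]
    rw [Finset.sum_comm]
    refine Finset.sum_eq_zero fun k _ => ?_
    have := congrArg (c k * ·) (sum_mul_eigenEquation_vector (u := u) ha k.2)
    simp only [Finset.mul_sum, mul_zero] at this
    refine Eq.trans (Finset.sum_congr rfl fun j _ => ?_) this
    ring
  · intro k
    simp only
    rw [Finset.sum_eq_single k]
    · simp
    · intro l _ hl
      have : ¬ (k : Fin n) = l := fun h => hl (Subtype.ext h.symm)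
      simp [this, k.2]
    · simp
  · rw [contract_sum_right]
    rfl

/-- The affine chart `u_a = 1` with its coordinate functions. -/
noncomputable def affineChart (a j : Fin n) : MvPolynomial {k // k ≠ a} ℝ :=
  if h : j = a then 1 else MvPolynomial.X ⟨j, h⟩

open MvPolynomial in
theorem aeval_affineChart {u : Fin n → ℝ} {a : Fin n} (ha : u a = 1) (j : Fin n) :
    aeval (fun k : {k // k ≠ a} => u k) (affineChart a j) = u j := by
  unfold affineChart
  split_ifs with h
  · subst h; simp [ha]
  · simp

-- The chart has `n - 1` parameters and there are `n - 1` equations. Coordinate vectors must be left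
-- out: they are eigenvectors of every tensor in `Vpmi`.
open MvPolynomial in
theorem eventually_eigenvector_avoids (he : 2 ≤ e) (a : Fin n) {R : MvPolynomial {k // k ≠ a} ℝ}
    (hR : R ≠ 0) : ∀ᶠ T in zariskiGeneric (VpmiSubmodule (e + 1) n), ∀ u : Fin n → ℝ,
      IsTensorEigenvector T u → u a = 1 → (∃ b ≠ a, u b ≠ 0) →
        aeval (fun k : {k // k ≠ a} => u k) R ≠ 0 := by
  filter_upwards [eventually_not_linear_conditions (VpmiSubmodule (e + 1) n) le_rfl
    (fun k : {k // k ≠ a} => eigenEquation (affineChart a) a k) hR] with T hT u hu ha hb hRu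
  obtain ⟨b, hba, hb⟩ := hb
  have hmap : ∀ (k : {k // k ≠ a}) (S : (Fin (e + 1) → Fin n) → ℝ),
      aeval (fun k : {k // k ≠ a} => u k) (eigenEquation (affineChart a) a k S)
        = eigenEquation u a k S := fun k S => by
    rw [map_eigenEquation]
    simp only [aeval_affineChart ha]
  refine hT _ hRu (fun k => ?_) fun c hc => ?_
  · rw [hmap, hu.eigenEquation_eq_zero ha k.2]
  · obtain ⟨w, _, hwc, hw⟩ := exists_contract_eq_sum_eigenEquation (e := e) ha c
    have hw0 : w = 0 := eq_zero_of_contract_eq_zero he hba.symm (by simp [ha]) hb fun S hS => by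
      rw [← hw, ← hc S hS]
      simp only [hmap]
    funext k
    rw [← hwc, hw0]; rfl

open MvPolynomial in
/-- For generic `T` in `Vpmi`, the eigenvectors that are not multiples of coordinate vectors are in
general position. -/
theorem eventually_eigenvector_general_position (he : 2 ≤ e) :
    ∀ᶠ T in zariskiGeneric (VpmiSubmodule (e + 1) n), ∀ (a : Fin n) (u : Fin n → ℝ),
      IsTensorEigenvector T u → u a = 1 → (∃ b ≠ a, u b ≠ 0) →
        (∀ j, u j ≠ 0) ∧ ∀ ε : Fin n → ℤˣ, ∑ j, ((ε j : ℤ) : ℝ) * u j ^ 2 ≠ 0 := by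
  have h1 : ∀ a j : Fin n, affineChart a j ≠ 0 := fun a j h0 => by
    have := aeval_affineChart (u := fun _ => (1 : ℝ)) (a := a) rfl j
    rw [h0, map_zero] at this
    exact zero_ne_one this
  have h2 : ∀ (a : Fin n) (ε : Fin n → ℤˣ),
      ∑ j, C ((ε j : ℤ) : ℝ) * affineChart a j ^ 2 ≠ 0 := fun a ε h0 => by
    have := congrArg (aeval fun k : {k // k ≠ a} => (Pi.single a (1 : ℝ) : Fin n → ℝ) k) h0
    simp only [map_sum, map_mul, map_pow, aeval_affineChart (u := (Pi.single a (1 : ℝ)))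
      (Pi.single_eq_same a 1), aeval_C, Algebra.algebraMap_self, RingHom.id_apply, map_zero] at this
    rw [Finset.sum_eq_single a (by intro j _ hj; simp [hj]) (by simp)] at this
    rcases Int.units_eq_one_or (ε a) with h | h <;> simp [h] at this
  have key := (Filter.eventually_all.mpr fun a => Filter.eventually_all.mpr fun j =>
      eventually_eigenvector_avoids he a (h1 a j)).and
    (Filter.eventually_all.mpr fun a => Filter.eventually_all.mpr fun ε =>
      eventually_eigenvector_avoids he a (h2 a ε))
  filter_upwards [key] with T hT a u hu ha hb
  refine ⟨fun j => ?_, fun ε => ?_⟩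
  · have := hT.1 a j u hu ha hb
    rwa [aeval_affineChart ha] at this
  · have := hT.2 a ε u hu ha hb
    simpa only [map_sum, map_mul, map_pow, aeval_affineChart ha, aeval_C, Algebra.algebraMap_self,
      RingHom.id_apply] using this

open MvPolynomial in
/-- For generic `T` in `Vpmi` of order at least four, no two orthogonal vectors in general position
are both eigenvectors. -/
theorem eventually_not_orthogonal_eigenvectors (he : 3 ≤ e) (a : Fin n) :
    ∀ᶠ T in zariskiGeneric (VpmiSubmodule (e + 1) n), ∀ u v : Fin n → ℝ,
      IsTensorEigenvector T u → IsTensorEigenvector T v → u a = 1 → v a = 1 →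
      (∀ j, u j ≠ 0) → (∀ j, v j ≠ 0) →
      (∀ ε : Fin n → ℤˣ, ∑ j, ((ε j : ℤ) : ℝ) * u j ^ 2 ≠ 0) → ∑ j, u j * v j ≠ 0 := by
  let ι := {k : Fin n // k ≠ a}
  let U : Fin n → MvPolynomial (ι ⊕ ι) ℝ := fun j => rename Sum.inl (affineChart a j)
  let V : Fin n → MvPolynomial (ι ⊕ ι) ℝ := fun j => rename Sum.inr (affineChart a j)
  let pt : (Fin n → ℝ) → (Fin n → ℝ) → ι ⊕ ι → ℝ := fun u v =>
    Sum.elim (fun k => u k) (fun k => v k)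
  have hU : ∀ (u v : Fin n → ℝ), u a = 1 → ∀ j, aeval (pt u v) (U j) = u j := fun u v ha j => by
    rw [← aeval_affineChart ha j]
    simp only [U, aeval_rename]
    rfl
  have hV : ∀ (u v : Fin n → ℝ), v a = 1 → ∀ j, aeval (pt u v) (V j) = v j := fun u v ha j => by
    rw [← aeval_affineChart ha j]
    simp only [V, aeval_rename]
    rfl
  have hR : ∑ j, U j * V j ≠ 0 := fun h0 => by
    have := congrArg (aeval (pt (Pi.single a 1) (Pi.single a 1))) h0
    have h1 : (Pi.single a 1 : Fin n → ℝ) a = 1 := Pi.single_eq_same a 1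
    simp only [map_sum, map_mul, hU _ _ h1, hV _ _ h1, map_zero] at this
    rw [Finset.sum_eq_single a (by intro j _ hj; simp [hj]) (by simp)] at this
    simp at this
  -- There are `2 (n - 1)` equations for `2 (n - 1)` parameters; orthogonality is the hypersurface
  -- that tips the count.
  let Φ : ι ⊕ ι → ((Fin (e + 1) → Fin n) → ℝ) →ₗ[ℝ] MvPolynomial (ι ⊕ ι) ℝ :=
    Sum.elim (fun k => eigenEquation U a k) (fun k => eigenEquation V a k)
  filter_upwards [eventually_not_linear_conditions (VpmiSubmodule (e + 1) n) le_rfl Φ hR]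
    with T hT u v hu hv hua hva hu0 hv0 hsign huv
  have hΦl : ∀ (k : ι) (S : (Fin (e + 1) → Fin n) → ℝ),
      aeval (pt u v) (Φ (Sum.inl k) S) = eigenEquation u a k S := fun k S => by
    simp only [Φ, Sum.elim_inl, map_eigenEquation, hU u v hua]
  have hΦr : ∀ (k : ι) (S : (Fin (e + 1) → Fin n) → ℝ),
      aeval (pt u v) (Φ (Sum.inr k) S) = eigenEquation v a k S := fun k S => by
    simp only [Φ, Sum.elim_inr, map_eigenEquation, hV u v hva]
  refine hT (pt u v) ?_ ?_ fun c hc => ?_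
  · simpa only [map_sum, map_mul, hU u v hua, hV u v hva] using huv
  · rintro (k | k)
    · rw [hΦl, hu.eigenEquation_eq_zero hua k.2]
    · rw [hΦr, hv.eigenEquation_eq_zero hva k.2]
  · obtain ⟨w, _, hwc, hw⟩ := exists_contract_eq_sum_eigenEquation (e := e) hua (c ∘ Sum.inl)
    obtain ⟨w', hvw', hwc', hw'⟩ := exists_contract_eq_sum_eigenEquation (e := e) hva (c ∘ Sum.inr)
    obtain ⟨h1, h2⟩ := eq_zero_of_contract_add_contract_eq_zero (w := w) he hu0 hv0 huv hsign hvw'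
      fun S hS => by
        rw [← hw, ← hw', ← hc S hS, Fintype.sum_sum_type]
        simp only [hΦl, hΦr, Function.comp]
        rfl
    funext k
    rcases k with k | k
    · have := hwc k
      rw [h1] at this
      exact this.symm
    · have := hwc' k
      rw [h2] at this
      exact this.symm

/-- The trace form `w ↦ ∑ k, T(w, e_k, …, e_k)` of a tensor, as a linear map in the tensor. For
order three this is the usual partial trace. -/
noncomputable def traceForm {S : Type*} [CommRing S] [Algebra ℝ S] (w : Fin n → S) :
    ((Fin (e + 1) → Fin n) → ℝ) →ₗ[ℝ] S :=
  ∑ k, contract (Pi.single k 1) w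

theorem traceForm_apply {S : Type*} [CommRing S] [Algebra ℝ S] (w : Fin n → S)
    (T : (Fin (e + 1) → Fin n) → ℝ) : traceForm w T = ∑ k, contract (Pi.single k 1) w T := by
  simp [traceForm]

theorem map_traceForm {S S' : Type*} [CommRing S] [Algebra ℝ S] [CommRing S'] [Algebra ℝ S']
    (f : S →ₐ[ℝ] S') (w : Fin n → S) (T : (Fin (e + 1) → Fin n) → ℝ) :
    f (traceForm w T) = traceForm (fun j => f (w j)) T := by
  simp only [traceForm_apply, map_sum, map_contract]
  refine Finset.sum_congr rfl fun k _ => ?_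
  congr 2
  funext j
  by_cases h : j = k
  · subst h; simp
  · simp [h]

theorem traceForm_smul (w : Fin n → ℝ) (s : ℝ) (T : (Fin (e + 1) → Fin n) → ℝ) :
    traceForm (s • w) T = s * traceForm w T := by
  simp only [traceForm_apply, Finset.mul_sum]
  refine Finset.sum_congr rfl fun k _ => ?_
  have := contract_sum_right (Pi.single k 1) (fun _ : Unit => s) (fun _ => w) T
  simp only [Finset.univ_unique, Finset.sum_const, Finset.card_singleton, one_smul] at this
  exact this

theorem traceForm_diagTensor (u : Fin n → ℝ) (j : Fin n) (he : e ≠ 0) :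
    traceForm u (diagTensor e j) = u j := by
  rw [traceForm_apply, Finset.sum_eq_single j] <;>
    simp +contextual [contract_diagTensor, he, eq_comm]

open Polynomial in
theorem traceForm_threeTensor (he : 2 ≤ e) {u : Fin n → ℝ} {a b c : Fin n} (hac : a ≠ c)
    (hbc : b ≠ c) (hc : u c = 0) : traceForm u (threeTensor e a b c) = 0 := by
  rw [traceForm_apply]
  refine Finset.sum_eq_zero fun k _ => ?_
  by_cases hk : c = k
  · subst hk
    rw [threeTensor, contract_productTensor]
    simp only [sum_smul_add_single]
    simp only [Pi.single_eq_same, Pi.single_eq_of_ne hac,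
      Pi.single_eq_of_ne hbc, Pi.zero_apply, smul_zero, Finset.sum_const_zero, add_zero, zero_smul,
      zero_add, one_smul]
    rw [coeffXY_apply, coeff_mul_X_pow', if_neg (by omega), coeff_zero]
  · rw [contract_threeTensor _ _ _ (by simp [hk]), hc, mul_zero]

/-- The equation `T(e_j, U, …, U) = tr(T)(U) U_j`, linear in `T`. -/
noncomputable def traceEquation {S : Type*} [CommRing S] [Algebra ℝ S] (U : Fin n → S)
    (j : Fin n) : ((Fin (e + 1) → Fin n) → ℝ) →ₗ[ℝ] S :=
  contract U (Pi.single j 1) - LinearMap.mulLeft ℝ (U j) ∘ₗ traceForm U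

theorem traceEquation_apply {S : Type*} [CommRing S] [Algebra ℝ S] (U : Fin n → S)
    (j : Fin n) (T : (Fin (e + 1) → Fin n) → ℝ) :
    traceEquation U j T = contract U (Pi.single j 1) T - U j * traceForm U T := rfl

theorem map_traceEquation {S S' : Type*} [CommRing S] [Algebra ℝ S] [CommRing S'] [Algebra ℝ S']
    (f : S →ₐ[ℝ] S') (U : Fin n → S) (j : Fin n) (T : (Fin (e + 1) → Fin n) → ℝ) :
    f (traceEquation U j T) = traceEquation (fun j => f (U j)) j T := by
  simp only [traceEquation_apply, map_sub, map_mul, map_traceForm, map_contract]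
  congr 3
  funext i
  by_cases h : i = j
  · subst h; simp
  · simp [h]

open MvPolynomial in
/-- For generic `T` in `Vpmi`, only multiples of coordinate vectors satisfy
`T(w, u, …, u) = tr(T)(u) ⟨w, u⟩`. -/
theorem eventually_traceEquation_ne_zero (a : Fin n) :
    ∀ᶠ T in zariskiGeneric (VpmiSubmodule (2 + 1) n), ∀ u : Fin n → ℝ, u a = 1 →
      (∃ b ≠ a, u b ≠ 0) → ∃ j, traceEquation u j T ≠ 0 := by
  -- All `n` coordinates serve as parameters, to match the `n` equations; the normalization `u a =
  -- 1` is the hypersurface.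
  have hR : (X a - 1 : MvPolynomial (Fin n) ℝ) ≠ 0 := fun h0 => by
    have := congrArg (aeval (0 : Fin n → ℝ)) h0
    simp at this
  filter_upwards [eventually_not_linear_conditions (VpmiSubmodule (2 + 1) n) le_rfl
    (fun j => traceEquation X j) hR] with T hT u ha hb
  obtain ⟨b, hba, hb⟩ := hb
  by_contra! hall
  have hmap : ∀ j (S : (Fin (2 + 1) → Fin n) → ℝ),
      aeval u (traceEquation X j S) = traceEquation u j S := fun j S => by
    rw [map_traceEquation]
    simp only [aeval_X]
  refine hT u (by simp [ha]) (fun j => by rw [hmap, hall]) fun c hc => ?_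
  have ha0 : u a ≠ 0 := by simp [ha]
  have key : ∀ S ∈ VpmiSubmodule (2 + 1) n,
      contract u c S - (∑ j, c j * u j) * traceForm u S = 0 := fun S hS => by
    rw [← hc S hS]
    simp only [hmap]
    simp only [traceEquation_apply, mul_sub, Finset.sum_sub_distrib]
    rw [← contract_sum_right, Finset.sum_mul]
    congr 1
    · congr 2
      funext i
      simp [Pi.single_apply]
    · exact Finset.sum_congr rfl fun j _ => by ring
  have h0 : ∀ j, u j = 0 → c j = 0 := fun j hj => by
    have haj : a ≠ j := by rintro rfl; exact ha0 hj
    have hbj : b ≠ j := by rintro rfl; exact hb hj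
    have := key _ (threeTensor_mem le_rfl hba.symm haj hbj)
    rw [traceForm_threeTensor le_rfl haj hbj hj, contract_threeTensor _ _ _ hj] at this
    simpa [ha0, hb] using this
  set t := ∑ j, c j * u j with ht
  have h1 : ∀ j, u j ≠ 0 → c j * u j = t := fun j hj => by
    have := key _ (diagTensor_mem two_ne_zero j)
    rw [traceForm_diagTensor _ _ two_ne_zero, contract_diagTensor] at this
    apply mul_right_cancel₀ hj
    linear_combination this
  -- Summing `c j * u j = t` over the support of `u` gives `t` times the size of the support, which
  -- is at least two.
  have ht0 : t = 0 := by
    have h2 : t = ∑ j, if u j ≠ 0 then t else 0 := by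
      conv_lhs => rw [ht]
      refine Finset.sum_congr rfl fun j _ => ?_
      split_ifs with hj
      · exact h1 j hj
      · rw [not_not.mp hj, mul_zero]
    rw [← Finset.sum_filter, Finset.sum_const, nsmul_eq_mul] at h2
    have h3 : 1 < (Finset.univ.filter fun j => u j ≠ 0).card :=
      Finset.one_lt_card.mpr ⟨a, by simp [ha], b, by simp [hb], hba.symm⟩
    have h4 : (1 : ℝ) < (Finset.univ.filter fun j => u j ≠ 0).card := by exact_mod_cast h3
    have h5 : (((Finset.univ.filter fun j => u j ≠ 0).card : ℝ) - 1) * t = 0 := by linarith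
    exact (mul_eq_zero.mp h5).resolve_left (by linarith)
  funext j
  by_cases hj : u j = 0
  · exact h0 j hj
  · exact (mul_eq_zero.mp ((h1 j hj).trans ht0)).resolve_right hj

/-- The trace of a cubic tensor may be computed in any orthonormal basis. -/
theorem sum_contract_orthogonal {Q : Matrix (Fin n) (Fin n) ℝ} (hQ : Q.transpose * Q = 1)
    (w : Fin n → ℝ) (T : (Fin (2 + 1) → Fin n) → ℝ) :
    ∑ k, contract (Q k) w T = traceForm w T := by
  have h1 : ∀ a b, ∑ k, Q k a * Q k b = if a = b then 1 else 0 := fun a b => by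
    have := congrFun (congrFun hQ a) b
    rw [Matrix.one_apply] at this
    simpa [Matrix.mul_apply] using this
  simp only [traceForm_apply, contract_apply, smul_eq_mul]
  rw [Finset.sum_comm, Finset.sum_comm (s := Finset.univ (α := Fin n))]
  refine Finset.sum_congr rfl fun idx _ => ?_
  simp only [← Finset.mul_sum, Fin.prod_univ_two]
  rw [h1]
  congr 2
  by_cases h : idx (Fin.succ 0) = idx (Fin.succ 1)
  · rw [if_pos h, h, Finset.sum_eq_single (idx (Fin.succ 1))] <;> simp +contextual [eq_comm]
  · rw [if_neg h]
    refine (Finset.sum_eq_zero fun k _ => ?_).symm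
    by_cases hk : idx (Fin.succ 0) = k
    · subst hk; simp [show idx 2 ≠ idx 1 from Ne.symm h]
    · simp [Pi.single_apply, show idx 1 ≠ k from hk]

/-- For generic `T` in `Vpmi`, the only orthonormal bases consisting of eigenvectors of `T` are
the signed permutations of the standard basis. -/
theorem eventually_orthogonal_eigenbasis_monomial (he : 2 ≤ e) :
    ∀ᶠ T in zariskiGeneric (VpmiSubmodule (e + 1) n), ∀ Q : Matrix (Fin n) (Fin n) ℝ,
      Q * Q.transpose = 1 → (∀ i j, i ≠ j → contract (Q j) (Q i) T = 0) →
        ∀ j a b, Q j a ≠ 0 → Q j b ≠ 0 → a = b := by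
  -- The trace equations serve order three, and pairs of orthogonal eigenvectors serve higher order.
  have hdiff : ∀ᶠ T in zariskiGeneric (VpmiSubmodule (e + 1) n), (e = 2 →
      ∀ (a : Fin n) (u : Fin n → ℝ), u a = 1 → (∃ b ≠ a, u b ≠ 0) → ∃ j, traceEquation u j T ≠ 0) ∧
      (3 ≤ e → ∀ (a : Fin n) (u v : Fin n → ℝ),
      IsTensorEigenvector T u → IsTensorEigenvector T v → u a = 1 → v a = 1 →
      (∀ j, u j ≠ 0) → (∀ j, v j ≠ 0) →
      (∀ ε : Fin n → ℤˣ, ∑ j, ((ε j : ℤ) : ℝ) * u j ^ 2 ≠ 0) → ∑ j, u j * v j ≠ 0) := by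
    rcases he.eq_or_lt with rfl | h3
    · filter_upwards [Filter.eventually_all.mpr fun a : Fin n =>
        eventually_traceEquation_ne_zero a] with T hT
      exact ⟨fun _ => hT, fun h => absurd h (by norm_num)⟩
    · filter_upwards [Filter.eventually_all.mpr fun a : Fin n =>
        eventually_not_orthogonal_eigenvectors h3 a] with T hT
      exact ⟨fun h => absurd h h3.ne', fun _ => hT⟩
  filter_upwards [hdiff, eventually_eigenvector_general_position he]
    with T hT hgen Q hQ hQT j a b ha hb
  by_contra hab
  have hQ' : Q.transpose * Q = 1 := mul_eq_one_comm.mp hQ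
  have horth : ∀ i k, ∑ l, Q i l * Q k l = if i = k then 1 else 0 := fun i k => by
    have := congrFun (congrFun hQ i) k
    rw [Matrix.one_apply] at this
    simpa [Matrix.mul_apply] using this
  have hexp : ∀ w : Fin n → ℝ, w = fun l => ∑ k, (∑ m, Q k m * w m) * Q k l := fun w => by
    have : Q.transpose.mulVec (Q.mulVec w) = w := by
      rw [Matrix.mulVec_mulVec, hQ', Matrix.one_mulVec]
    conv_lhs => rw [← this]
    funext l
    simp only [Matrix.mulVec, dotProduct, Matrix.transpose_apply]
    exact Finset.sum_congr rfl fun _ _ => mul_comm _ _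
  -- Expanding `w` in the orthonormal rows leaves only its component along `Q i`, so every row is an
  -- eigenvector.
  have hcontr : ∀ i (w : Fin n → ℝ),
      contract (Q i) w T = (∑ m, Q i m * w m) * contract (Q i) (Q i) T := fun i w => by
    conv_lhs => rw [hexp w]
    refine (contract_sum_right (Q i) (fun k => ∑ m, Q k m * w m) (fun k => Q k) T).trans ?_
    rw [Finset.sum_eq_single i]
    · intro k _ hk
      rw [hQT k i hk, mul_zero]
    · simp
  have heig : ∀ i, IsTensorEigenvector T (Q i) := fun i w hw => by rw [hcontr, hw, zero_mul]
  have hscale : ∀ i c, Q i c ≠ 0 → ((Q i c)⁻¹ • Q i) c = 1 := fun i c hc => by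
    simp [hc]
  rcases he.eq_or_lt with rfl | h3
  · obtain ⟨i, hi⟩ := hT.1 rfl a ((Q j a)⁻¹ • Q j) (hscale j a ha)
      ⟨b, Ne.symm hab, by simp [ha, hb]⟩
    apply hi
    -- Computed in the basis of rows, the trace at `Q j` loses every term `T(Q j, Q k, Q k)` with `k
    -- ≠ j`; what remains is the eigenvalue.
    have htr : traceForm (Q j) T = contract (Q j) (Q j) T := by
      rw [← sum_contract_orthogonal hQ', Finset.sum_eq_single j]
      · intro k _ hk
        exact hQT j k hk.symm
      · simp
    rw [traceEquation_apply, contract_smul_left, traceForm_smul, htr, hcontr]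
    simp [Pi.single_apply]
    ring
  · have hpos : ∀ i c d, c ≠ d → Q i c ≠ 0 → Q i d ≠ 0 → (∀ l, Q i l ≠ 0) ∧
        ∀ ε : Fin n → ℤˣ, ∑ l, ((ε l : ℤ) : ℝ) * ((Q i c)⁻¹ • Q i) l ^ 2 ≠ 0 := by
      intro i c d hcd hc hd
      obtain ⟨h1, h2⟩ := hgen c ((Q i c)⁻¹ • Q i) ((heig i).smul (inv_ne_zero hc)) (hscale i c hc)
        ⟨d, hcd.symm, by simp [hc, hd]⟩
      exact ⟨fun l h0 => h1 l (by simp [h0]), h2⟩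
    obtain ⟨hj, hsign⟩ := hpos j a b hab ha hb
    obtain ⟨i, hij⟩ : ∃ i, j ≠ i := by
      by_cases h : j = a
      · exact ⟨b, by rw [h]; exact hab⟩
      · exact ⟨a, h⟩
    have hji : ∑ l, Q j l * Q i l = 0 := by rw [horth, if_neg hij]
    -- A multiple of a coordinate vector cannot be orthogonal to `Q j`, which has no zero entry; so
    -- `Q i` is in general position too.
    have hi : ∀ l, Q i l ≠ 0 := by
      obtain ⟨c, hc⟩ : ∃ c, Q i c ≠ 0 := by
        by_contra! h0
        have := horth i i
        simp [h0] at this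
      by_cases hd : ∃ d, c ≠ d ∧ Q i d ≠ 0
      · obtain ⟨d, hcd, hd⟩ := hd
        exact (hpos i c d hcd hc hd).1
      · push Not at hd
        rw [Finset.sum_eq_single c (fun l _ hl => by rw [hd l hl.symm, mul_zero]) (by simp)] at hji
        exact absurd hji (mul_ne_zero (hj c) hc)
    refine hT.2 h3 a _ _ ((heig j).smul (inv_ne_zero ha)) ((heig i).smul (inv_ne_zero (hi a)))
      (hscale j a ha) (hscale i a (hi a)) (fun l => by simp [ha, hj l])
      (fun l => by simp [hi a, hi l]) hsign ?_
    have : ∑ l, ((Q j a)⁻¹ • Q j) l * ((Q i a)⁻¹ • Q i) l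
        = (Q j a)⁻¹ * (Q i a)⁻¹ * ∑ l, Q j l * Q i l := by
      rw [Finset.mul_sum]
      exact Finset.sum_congr rfl fun l _ => by simp; ring
    rw [this, hji, mul_zero]

end Eigenvectors

/-! ### Multilinearity of cumulants and membership in `Vpmi` -/

section Cumulants

variable {Ω : Type*} [MeasurableSpace Ω] {n d : ℕ}

/-- The joint cumulant of a finite family of random variables. -/
noncomputable def jointCumulant (μ : Measure Ω) (Y : Fin d → Ω → ℝ) : ℝ :=
  ∑ π : Finpartition (Finset.univ : Finset (Fin d)),
    (-1 : ℝ) ^ (π.parts.card - 1) * (Nat.factorial (π.parts.card - 1) : ℝ) *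
      ∏ B ∈ π.parts, ∫ ω, ∏ k ∈ B, Y k ω ∂μ

theorem cumulantTensor_eq_jointCumulant (μ : Measure Ω) (z : Ω → Fin n → ℝ) (d : ℕ)
    (idx : Fin d → Fin n) :
    cumulantTensor μ z d idx = jointCumulant μ fun k ω => z ω (idx k) := rfl

/-- The action of a permutation on finite sets as an order isomorphism. -/
def finsetOrderIsoOfPerm {α : Type*} (σ : Equiv.Perm α) : Finset α ≃o Finset α where
  toEquiv := σ.finsetCongr
  map_rel_iff' := Finset.map_subset_map

theorem jointCumulant_comp_perm (μ : Measure Ω) (Y : Fin d → Ω → ℝ) (σ : Equiv.Perm (Fin d)) :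
    jointCumulant μ (Y ∘ σ) = jointCumulant μ Y := by
  have huniv : ∀ σ : Equiv.Perm (Fin d), finsetOrderIsoOfPerm σ Finset.univ = Finset.univ :=
    fun σ => Finset.map_univ_equiv σ
  let m : Equiv.Perm (Fin d) → Finpartition (Finset.univ : Finset (Fin d)) →
      Finpartition (Finset.univ : Finset (Fin d)) :=
    fun σ π => (π.map (finsetOrderIsoOfPerm σ)).copy (huniv σ)
  have hparts : ∀ σ π, (m σ π).parts
      = π.parts.map (finsetOrderIsoOfPerm σ).toEquiv.toEmbedding := fun σ π => rfl
  have hinv : ∀ (σ τ : Equiv.Perm (Fin d)) π, (∀ k, σ (τ k) = k) → m σ (m τ π) = π := by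
    intro σ τ π h
    ext1
    rw [hparts, hparts, Finset.map_map]
    convert Finset.map_refl using 2
    ext B
    simp only [Function.Embedding.trans_apply, Equiv.coe_toEmbedding, finsetOrderIsoOfPerm,
      Equiv.finsetCongr_apply, Finset.map_map, Function.Embedding.refl_apply]
    simp [Finset.mem_map, h]
  refine Finset.sum_bij' (fun π _ => m σ π) (fun π _ => m σ⁻¹ π) (fun _ _ => Finset.mem_univ _)
    (fun _ _ => Finset.mem_univ _) (fun π _ => hinv _ _ _ (by simp)) (fun π _ => hinv _ _ _ (by simp))
    fun π _ => ?_
  rw [hparts, Finset.card_map, Finset.prod_map]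
  congr 1
  refine Finset.prod_congr rfl fun B _ => ?_
  have : (finsetOrderIsoOfPerm σ).toEquiv.toEmbedding B = B.map σ.toEmbedding := rfl
  rw [this]
  simp only [Finset.prod_map]
  rfl

/-- Hölder's inequality: at most `d` factors in `L^d` have their product in `L^1` on a finite
measure space. -/
theorem integrable_prod_of_memLp {μ : Measure Ω} [IsFiniteMeasure μ] {κ : Type*} {B : Finset κ}
    (hB : B.card ≤ d) {Y : κ → Ω → ℝ} (hY : ∀ k ∈ B, MemLp (Y k) d μ) :
    Integrable (fun ω => ∏ k ∈ B, Y k ω) μ := by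
  have h := MemLp.prod' (p := fun _ => (d : ENNReal)) hY
  refine memLp_one_iff_integrable.mp (h.mono_exponent ?_)
  rw [Finset.sum_const, nsmul_eq_mul, ENNReal.one_le_inv, ← div_eq_mul_inv]
  refine ENNReal.div_le_of_le_mul ?_
  rw [one_mul]
  exact_mod_cast hB

/-- Functions with finite `d`-th absolute moment. -/
def memLpSubmodule (d : ℕ) (μ : Measure Ω) : Submodule ℝ (Ω → ℝ) where
  carrier := {f | MemLp f d μ}
  zero_mem' := MemLp.zero
  add_mem' := fun hf hg => hf.add hg
  smul_mem' := fun c _ hf => hf.const_smul c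

/-- Only the block containing `k` involves the `k`-th variable. Each summand is thus linear in it,
which yields multilinearity. -/
theorem jointCumulant_update (μ : Measure Ω) (Y : Fin d → Ω → ℝ) (k : Fin d) (f : Ω → ℝ) :
    jointCumulant μ (Function.update Y k f)
      = ∑ π : Finpartition (Finset.univ : Finset (Fin d)),
        (-1 : ℝ) ^ (π.parts.card - 1) * (Nat.factorial (π.parts.card - 1) : ℝ) *
          ((∫ ω, f ω * ∏ l ∈ (π.part k).erase k, Y l ω ∂μ) *
            ∏ B ∈ π.parts.erase (π.part k), ∫ ω, ∏ l ∈ B, Y l ω ∂μ) := by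
  refine Finset.sum_congr rfl fun π _ => ?_
  have hk : π.part k ∈ π.parts := π.part_mem.mpr (Finset.mem_univ k)
  have hkk : k ∈ π.part k := π.mem_part (Finset.mem_univ k)
  rw [← Finset.mul_prod_erase _ _ hk]
  congr 2
  · refine integral_congr_ae (Filter.Eventually.of_forall fun ω => ?_)
    simp only
    rw [← Finset.mul_prod_erase _ _ hkk, Function.update_self]
    congr 1
    refine Finset.prod_congr rfl fun l hl => ?_
    rw [Function.update_of_ne (Finset.ne_of_mem_erase hl)]
  · refine Finset.prod_congr rfl fun B hB => ?_
    refine integral_congr_ae (Filter.Eventually.of_forall fun ω => ?_)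
    refine Finset.prod_congr rfl fun l hl => ?_
    rw [Function.update_of_ne]
    rintro rfl
    exact (Finset.mem_erase.mp hB).1 (π.part_eq_of_mem (Finset.mem_erase.mp hB).2 hl).symm

/-- The joint cumulant as a multilinear map. -/
noncomputable def jointCumulantMultilinear (d : ℕ) (μ : Measure Ω) [IsFiniteMeasure μ] :
    MultilinearMap ℝ (fun _ : Fin d => memLpSubmodule d μ) ℝ :=
  have hupd : ∀ (Y : Fin d → memLpSubmodule d μ) k f,
      (fun l => (Function.update Y k f l : Ω → ℝ))
        = Function.update (fun l => (Y l : Ω → ℝ)) k (f : Ω → ℝ) := fun Y k f => by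
    funext l
    by_cases h : l = k
    · subst h; simp
    · simp [h]
  MultilinearMap.mk' (fun Y => jointCumulant μ fun k => (Y k : Ω → ℝ))
    (fun Y k f g => by
      simp only [hupd, jointCumulant_update]
      rw [← Finset.sum_add_distrib]
      refine Finset.sum_congr rfl fun π _ => ?_
      have hint : ∀ h : memLpSubmodule d μ,
          Integrable (fun ω => (h : Ω → ℝ) ω * ∏ l ∈ (π.part k).erase k, (Y l : Ω → ℝ) ω) μ := by
        intro h
        have hkk : k ∈ π.part k := π.mem_part (Finset.mem_univ k)
        have := integrable_prod_of_memLp (by simpa using Finset.card_le_univ (π.part k))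
          fun l _ => (Function.update Y k h l).2
        refine this.congr (Filter.Eventually.of_forall fun ω => ?_)
        simp only
        rw [← Finset.mul_prod_erase _ _ hkk, Function.update_self]
        congr 1
        refine Finset.prod_congr rfl fun l hl => ?_
        rw [Function.update_of_ne (Finset.ne_of_mem_erase hl)]
      have hadd : ∀ ω, ((f + g : memLpSubmodule d μ) : Ω → ℝ) ω = (f : Ω → ℝ) ω + (g : Ω → ℝ) ω :=
        fun ω => rfl
      simp only [hadd, add_mul]
      rw [integral_add (hint f) (hint g)]
      ring)
    (fun Y k c f => by
      simp only [hupd, jointCumulant_update]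
      rw [Finset.smul_sum]
      refine Finset.sum_congr rfl fun π _ => ?_
      have hsmul : ∀ ω, ((c • f : memLpSubmodule d μ) : Ω → ℝ) ω = c * (f : Ω → ℝ) ω :=
        fun ω => rfl
      simp only [hsmul, mul_assoc, integral_const_mul, smul_eq_mul]
      ring)

theorem jointCumulantMultilinear_apply (μ : Measure Ω) [IsFiniteMeasure μ]
    (Y : Fin d → memLpSubmodule d μ) :
    jointCumulantMultilinear d μ Y = jointCumulant μ fun k => (Y k : Ω → ℝ) := rfl

theorem jointCumulant_linear_combination (μ : Measure Ω) [IsFiniteMeasure μ]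
    {z : Ω → Fin n → ℝ} (hz : ∀ i, MemLp (fun ω => z ω i) d μ) (M : Fin d → Fin n → ℝ) :
    jointCumulant μ (fun k ω => ∑ j, M k j * z ω j)
      = ∑ idx : Fin d → Fin n, (∏ k, M k (idx k)) * cumulantTensor μ z d idx := by
  let Z : Fin n → memLpSubmodule d μ := fun j => ⟨fun ω => z ω j, hz j⟩
  have h1 : jointCumulant μ (fun k ω => ∑ j, M k j * z ω j)
      = jointCumulantMultilinear d μ fun k => ∑ j, M k j • Z j := by
    rw [jointCumulantMultilinear_apply]
    congr 1
    funext k ω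
    rw [Submodule.coe_sum, Finset.sum_apply]
    rfl
  rw [h1, MultilinearMap.map_sum]
  refine Finset.sum_congr rfl fun idx _ => ?_
  rw [MultilinearMap.map_smul_univ, jointCumulantMultilinear_apply]
  rfl

theorem contract_cumulantTensor (μ : Measure Ω) [IsFiniteMeasure μ] {e : ℕ}
    {z : Ω → Fin n → ℝ} (hz : ∀ i, MemLp (fun ω => z ω i) ((e + 1 : ℕ) : ENNReal) μ)
    (u w : Fin n → ℝ) :
    contract u w (cumulantTensor μ z (e + 1))
      = jointCumulant μ (Fin.cons (fun ω => ∑ j, w j * z ω j) fun _ ω => ∑ j, u j * z ω j :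
          Fin (e + 1) → Ω → ℝ) := by
  have := jointCumulant_linear_combination μ hz (Fin.cons w fun _ => u)
  have h2 : (fun k ω => ∑ j, (Fin.cons w fun _ => u : Fin (e + 1) → Fin n → ℝ) k j * z ω j)
      = Fin.cons (fun ω => ∑ j, w j * z ω j) fun _ ω => ∑ j, u j * z ω j := by
    funext k
    refine Fin.cases ?_ (fun k => ?_) k <;> simp
  rw [h2] at this
  rw [this, contract_apply]
  refine Finset.sum_congr rfl fun idx _ => ?_
  rw [Fin.prod_univ_succ, smul_eq_mul, mul_comm]
  simp

/-- Cumulant tensors lie in `Vpmi` as soon as the mixed moments `𝔼 (z_i z_j ^ m)` vanish. -/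
theorem cumulantTensor_mem_Vpmi {μ : Measure Ω} {z : Ω → Fin n → ℝ}
    (h : ∀ i j, i ≠ j → ∀ m < d, ∫ ω, z ω i * z ω j ^ m ∂μ = 0) :
    cumulantTensor μ z d ∈ VpmiSubmodule d n := by
  refine ⟨fun σ idx => ?_, fun k i j hij => ?_⟩
  · exact jointCumulant_comp_perm μ (fun k ω => z ω (idx k)) σ
  · refine Finset.sum_eq_zero fun π _ => mul_eq_zero_of_right _ ?_
    have hkk : k ∈ π.part k := π.mem_part (Finset.mem_univ k)
    -- The block of `k` contributes `𝔼 (z_i z_j ^ m)` with `m` one less than its size, hence below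
    -- `d`.
    refine Finset.prod_eq_zero (π.part_mem.mpr (Finset.mem_univ k)) ?_
    rw [← h i j hij ((π.part k).card - 1)]
    · refine integral_congr_ae (Filter.Eventually.of_forall fun ω => ?_)
      simp only
      rw [← Finset.mul_prod_erase _ _ hkk, Function.update_self,
        ← Finset.card_erase_of_mem hkk, ← Finset.prod_const]
      congr 1
      refine Finset.prod_congr rfl fun l hl => ?_
      rw [Function.update_of_ne (Finset.ne_of_mem_erase hl)]
    · have h1 := Finset.card_le_univ (π.part k)
      have h2 := Finset.card_pos.mpr ⟨k, hkk⟩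
      rw [Fintype.card_fin] at h1
      omega

/-- A centred coordinate of a pairwise mean independent vector is orthogonal to every function of
another coordinate. -/
theorem PairwiseMeanIndep.integral_mul_comp_eq_zero {μ : Measure Ω} [IsProbabilityMeasure μ]
    {s : Ω → Fin n → ℝ} (hs : PairwiseMeanIndep μ s) (hm : Measurable s) {i j : Fin n} (hij : i ≠ j)
    {g : ℝ → ℝ} (hg : Measurable g)
    (hint : Integrable (fun ω => (s ω i - ∫ ω', s ω' i ∂μ) * g (s ω j)) μ) :
    ∫ ω, (s ω i - ∫ ω', s ω' i ∂μ) * g (s ω j) ∂μ = 0 := by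
  have hmj : Measurable fun ω => s ω j := (measurable_pi_apply j).comp hm
  set c := ∫ ω', s ω' i ∂μ with hc
  have hle := hmj.comap_le
  have hgm : StronglyMeasurable[MeasurableSpace.comap (fun ω => s ω j) inferInstance] fun ω => g (s ω j) :=
    (hg.comp (comap_measurable fun ω => s ω j)).stronglyMeasurable
  have hf : Integrable (fun ω => s ω i - c) μ := (hs.1 i).sub (integrable_const c)
  have h1 := condExp_mul_of_stronglyMeasurable_right (μ := μ) hgm hint hf
  have h2 : μ[fun ω => s ω i - c | MeasurableSpace.comap (fun ω => s ω j) inferInstance] =ᵐ[μ] 0 := by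
    have h3 := condExp_sub (μ := μ) (hs.1 i) (integrable_const c)
      (MeasurableSpace.comap (fun ω => s ω j) inferInstance)
    have h4 := hs.2 i j hij
    filter_upwards [h3, h4] with ω h3 h4
    refine Eq.trans h3 ?_
    rw [Pi.sub_apply, h4, condExp_const hle c]
    simp [hc]
  -- The function of `s j` is pulled out of the conditional expectation, and the centred `s i` has
  -- conditional mean zero.
  have h5 : μ[(fun ω => s ω i - c) * (fun ω => g (s ω j)) | MeasurableSpace.comap (fun ω => s ω j) inferInstance] =ᵐ[μ] 0 := by
    filter_upwards [h1, h2] with ω h1 h2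
    rw [h1, Pi.mul_apply, h2]
    simp
  calc ∫ ω, (s ω i - c) * g (s ω j) ∂μ
      = ∫ ω, (μ[(fun ω => s ω i - c) * (fun ω => g (s ω j)) | MeasurableSpace.comap (fun ω => s ω j) inferInstance]) ω ∂μ :=
        (integral_condExp hle).symm
    _ = 0 := by rw [integral_congr_ae h5]; simp

theorem memLp_standardize {μ : Measure Ω} [IsFiniteMeasure μ] {s : Ω → Fin n → ℝ}
    (hs : ∀ i, MemLp (fun ω => s ω i) d μ) (i : Fin n) :
    MemLp (fun ω => standardize μ s ω i) d μ := by
  have := ((hs i).sub (memLp_const (∫ ω', s ω' i ∂μ))).mul_const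
    (√(variance (fun ω' => s ω' i) μ))⁻¹
  exact this

theorem PairwiseMeanIndep.integral_standardize_mul_pow {μ : Measure Ω} [IsProbabilityMeasure μ]
    {s : Ω → Fin n → ℝ} (hs : PairwiseMeanIndep μ s) (hm : Measurable s)
    (hmem : ∀ i, MemLp (fun ω => s ω i) d μ) {i j : Fin n} (hij : i ≠ j) {m : ℕ} (hmd : m < d) :
    ∫ ω, standardize μ s ω i * standardize μ s ω j ^ m ∂μ = 0 := by
  set a := ∫ ω', s ω' i ∂μ with ha
  set b := ∫ ω', s ω' j ∂μ
  set x := √(variance (fun ω' => s ω' i) μ)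
  set y := √(variance (fun ω' => s ω' j) μ)
  have hcent : ∀ k (c : ℝ), MemLp (fun ω => s ω k - c) d μ := fun k c =>
    (hmem k).sub (memLp_const c)
  have hint : Integrable (fun ω => (s ω i - a) * ((s ω j - b) / y) ^ m) μ := by
    have h := integrable_prod_of_memLp (μ := μ) (d := d) (κ := Fin (m + 1)) (B := Finset.univ)
      (Y := Fin.cons (fun ω => s ω i - a) fun _ ω => (s ω j - b) / y) (by simp; omega)
      (by
        intro k _
        refine Fin.cases ?_ (fun k => ?_) k
        · exact hcent i a
        · exact (hcent j b).mul_const y⁻¹)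
    simpa [Fin.prod_univ_succ, div_pow] using h
  have := hs.integral_mul_comp_eq_zero hm hij (g := fun t => ((t - b) / y) ^ m) (by fun_prop) hint
  calc ∫ ω, standardize μ s ω i * standardize μ s ω j ^ m ∂μ
      = ∫ ω, x⁻¹ * ((s ω i - a) * ((s ω j - b) / y) ^ m) ∂μ := by
        refine integral_congr_ae (Filter.Eventually.of_forall fun ω => ?_)
        simp only [standardize]
        ring
    _ = 0 := by rw [integral_const_mul, this, mul_zero]

end Cumulants

/-! ### Symmetric tensors through multiplicities of indices -/

section FiberCount

variable {n d : ℕ}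

/-- The number of times the index `i` occurs in `idx`. -/
def fiberCount (idx : Fin d → Fin n) (i : Fin n) : ℕ :=
  (Finset.univ.filter fun k => idx k = i).card

/-- The number of index tuples of length `d` with prescribed numbers of occurrences. -/
def fiberMultiplicity (d : ℕ) (β : Fin n → ℕ) : ℕ :=
  (Finset.univ.filter fun idx : Fin d → Fin n => fiberCount idx = β).card

theorem sum_fiberCount (idx : Fin d → Fin n) : ∑ i, fiberCount idx i = d := by
  have := Finset.card_eq_sum_card_fiberwise (f := idx) (s := Finset.univ) (t := Finset.univ)
    (fun _ _ => Finset.mem_univ _)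
  simpa [fiberCount] using this.symm

theorem fiberCount_le (idx : Fin d → Fin n) (i : Fin n) : fiberCount idx i ≤ d := by
  simpa [fiberCount] using Finset.card_le_univ (Finset.univ.filter fun k => idx k = i)

theorem exists_perm_of_fiberCount_eq {idx idx' : Fin d → Fin n}
    (h : fiberCount idx = fiberCount idx') : ∃ σ : Equiv.Perm (Fin d), idx' ∘ σ = idx := by
  have hc : ∀ i, Nonempty ({k // idx k = i} ≃ {k // idx' k = i}) := fun i => by
    refine ⟨Fintype.equivOfCardEq ?_⟩
    rw [Fintype.card_subtype, Fintype.card_subtype]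
    exact congrFun h i
  let f := fun i => (hc i).some
  refine ⟨(Equiv.sigmaFiberEquiv idx).symm.trans
    ((Equiv.sigmaCongrRight f).trans (Equiv.sigmaFiberEquiv idx')), funext fun k => ?_⟩
  exact (f (idx k) ⟨k, rfl⟩).2

theorem eq_of_fiberCount_eq {T : (Fin d → Fin n) → ℝ} (hT : T ∈ VpmiSubmodule d n)
    {idx idx' : Fin d → Fin n} (h : fiberCount idx = fiberCount idx') : T idx = T idx' := by
  obtain ⟨σ, rfl⟩ := exists_perm_of_fiberCount_eq h
  exact hT.1 σ idx'

theorem eq_zero_of_fiberCount {T : (Fin d → Fin n) → ℝ} (hT : T ∈ VpmiSubmodule d n)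
    {idx : Fin d → Fin n} {i j : Fin n} (hij : i ≠ j) (hi : fiberCount idx i = 1)
    (hk : ∀ k, k ≠ i → k ≠ j → fiberCount idx k = 0) : T idx = 0 := by
  obtain ⟨k, hk1⟩ := Finset.card_eq_one.mp hi
  have hki : ∀ l, idx l = i ↔ l = k := fun l => by
    have := Finset.ext_iff.mp hk1 l
    simpa using this
  have : idx = Function.update (fun _ => j) k i := by
    funext l
    by_cases hl : l = k
    · subst hl; simpa using (hki l).mpr rfl
    · rw [Function.update_of_ne hl]
      by_contra hj
      have h0 := hk (idx l) (fun h => hl ((hki l).mp h)) hj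
      exact (Finset.card_ne_zero.mpr ⟨l, by simp⟩) h0
  rw [this]
  exact hT.2 k i j hij

end FiberCount

/-! ### Finitely supported laws on a grid -/

section GridMeasure

variable {n m : ℕ}

/-- The measure with mass `p y` at the grid point with coordinates `g (y i)`. -/
noncomputable def gridMeasure (g : Fin m → ℝ) (p : (Fin n → Fin m) → ℝ) : Measure (Fin n → ℝ) :=
  ∑ y, ENNReal.ofReal (p y) • Measure.dirac fun i => g (y i)

theorem integrable_gridMeasure (g : Fin m → ℝ) (p : (Fin n → Fin m) → ℝ) (f : (Fin n → ℝ) → ℝ) :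
    Integrable f (gridMeasure g p) := by
  rw [gridMeasure, integrable_finsetSum_measure]
  exact fun y _ => (integrable_dirac (by simp)).smul_measure (by simp)

theorem integral_gridMeasure (g : Fin m → ℝ) {p : (Fin n → Fin m) → ℝ} (hp : ∀ y, 0 ≤ p y)
    (f : (Fin n → ℝ) → ℝ) : ∫ x, f x ∂gridMeasure g p = ∑ y, p y * f fun i => g (y i) := by
  rw [gridMeasure, integral_finsetSum_measure]
  · refine Finset.sum_congr rfl fun y _ => ?_
    rw [integral_smul_measure, integral_dirac, ENNReal.toReal_ofReal (hp y), smul_eq_mul]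
  · exact fun y _ => (integrable_dirac (by simp)).smul_measure (by simp)

theorem isProbabilityMeasure_gridMeasure (g : Fin m → ℝ) {p : (Fin n → Fin m) → ℝ}
    (hp : ∀ y, 0 ≤ p y) (hsum : ∑ y, p y = 1) : IsProbabilityMeasure (gridMeasure g p) := by
  constructor
  simp only [gridMeasure, Measure.coe_finsetSum, Finset.sum_apply, Measure.smul_apply,
    measure_univ, smul_eq_mul, mul_one]
  rw [← ENNReal.ofReal_sum_of_nonneg fun y _ => hp y, hsum, ENNReal.ofReal_one]

theorem isPMISource_gridMeasure (g : Fin m → ℝ) {p : (Fin n → Fin m) → ℝ}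
    (hp : ∀ y, 0 ≤ p y) (hsum : ∑ y, p y = 1) (hmean : ∀ i, ∑ y, p y * g (y i) = 0)
    (hvar : ∀ i, ∑ y, p y * g (y i) ^ 2 = 1)
    (hpmi : ∀ i j, i ≠ j → ∀ φ : ℝ → ℝ, ∑ y, p y * (g (y i) * φ (g (y j))) = 0) (d : ℕ)
    (hd : d ≠ 0) :
    IsPMISource (gridMeasure g p) d (fun y => y) ∧
      standardize (gridMeasure g p) (fun y => y) = fun y => y := by
  have := isProbabilityMeasure_gridMeasure g hp hsum
  have hmean' : ∀ i, ∫ x, x i ∂gridMeasure g p = 0 := fun i => by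
    rw [integral_gridMeasure g hp, hmean]
  have hvar' : ∀ i, variance (fun x : Fin n → ℝ => x i) (gridMeasure g p) = 1 := fun i => by
    rw [variance_of_integral_eq_zero (measurable_pi_apply i).aemeasurable (hmean' i),
      integral_gridMeasure g hp]
    exact hvar i
  refine ⟨⟨measurable_id, ⟨fun i => integrable_gridMeasure g p _, fun i j hij => ?_⟩, fun i => ?_,
    fun i => by rw [hvar']; exact one_ne_zero⟩, ?_⟩
  · symm
    refine ae_eq_condExp_of_forall_setIntegral_eq (measurable_pi_apply j).comap_le
      (integrable_gridMeasure g p _) (fun s _ _ => (integrable_gridMeasure g p _).integrableOn)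
      (fun s hs _ => ?_) aestronglyMeasurable_const
    obtain ⟨U, hU, rfl⟩ := hs
    rw [hmean', integral_zero]
    rw [← integral_indicator ((measurable_pi_apply j) hU), integral_gridMeasure g hp]
    classical
    -- Events generated by the `j`-th coordinate are preimages of sets `U`, so indicators suffice as
    -- test functions.
    have := hpmi i j hij (U.indicator 1)
    rw [← this]
    refine Finset.sum_congr rfl fun y _ => ?_
    by_cases hy : g (y j) ∈ U <;> simp [Set.indicator, hy]
  · rw [← integrable_norm_rpow_iff (measurable_pi_apply i).aestronglyMeasurable
      (by exact_mod_cast hd) (by simp)]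
    exact integrable_gridMeasure g p _
  · funext y i
    simp [standardize, hmean', hvar']

end GridMeasure

/-! ### Realizing small elements of `Vpmi` as changes of cumulants -/

section Perturbation

variable {n d : ℕ}

theorem sum_prod_eq_prod_sum {m : ℕ} (F : Fin n → Fin m → ℝ) :
    ∑ y : Fin n → Fin m, ∏ i, F i (y i) = ∏ i, ∑ t, F i t :=
  (Fintype.prod_sum F).symm

/-- A signed perturbation of weights on a grid whose moments of order `d` are the entries of `T` and
whose lower moments vanish, provided that `q k` is a signed measure with `k`-th moment one and the
other moments up to order `d` zero. -/
noncomputable def gridPerturbation {m : ℕ} (q : ℕ → Fin m → ℝ) (T : (Fin d → Fin n) → ℝ)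
    (y : Fin n → Fin m) : ℝ :=
  -- All rearrangements of `idx` contribute to the same moment, hence the division by their number.
  ∑ idx, T idx * (fiberMultiplicity d (fiberCount idx) : ℝ)⁻¹ *
    ∏ i, q (fiberCount idx i) (y i)

theorem sum_gridPerturbation_mul_prod {m : ℕ} (q : ℕ → Fin m → ℝ) (T : (Fin d → Fin n) → ℝ)
    (F : Fin n → Fin m → ℝ) :
    ∑ y, gridPerturbation q T y * ∏ i, F i (y i) = ∑ idx, T idx *
      (fiberMultiplicity d (fiberCount idx) : ℝ)⁻¹ *
        ∏ i, ∑ t, q (fiberCount idx i) t * F i t := by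
  simp only [gridPerturbation, Finset.sum_mul]
  rw [Finset.sum_comm]
  refine Finset.sum_congr rfl fun idx _ => ?_
  rw [← sum_prod_eq_prod_sum, Finset.mul_sum]
  refine Finset.sum_congr rfl fun y _ => ?_
  rw [Finset.prod_mul_distrib]
  ring

variable {g : Fin (d + 1) → ℝ} {q : ℕ → Fin (d + 1) → ℝ}

theorem sum_gridPerturbation_mul_monomial
    (hq : ∀ k ≤ d, ∀ l ≤ d, ∑ t, q k t * g t ^ l = if k = l then 1 else 0)
    {T : (Fin d → Fin n) → ℝ} {β : Fin n → ℕ} (hβ : ∀ i, β i ≤ d) :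
    ∑ y, gridPerturbation q T y * ∏ i, g (y i) ^ β i = ∑ idx, if fiberCount idx = β then T idx *
      (fiberMultiplicity d β : ℝ)⁻¹ else 0 := by
  rw [sum_gridPerturbation_mul_prod q T fun i t => g t ^ β i]
  refine Finset.sum_congr rfl fun idx _ => ?_
  simp only [hq _ (fiberCount_le idx _) _ (hβ _)]
  split_ifs with h
  · subst h; simp
  · obtain ⟨i, hi⟩ := Function.ne_iff.mp h
    rw [Finset.prod_eq_zero (Finset.mem_univ i) (if_neg hi), mul_zero]

theorem sum_gridPerturbation_mul_monomial_of_ne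
    (hq : ∀ k ≤ d, ∀ l ≤ d, ∑ t, q k t * g t ^ l = if k = l then 1 else 0)
    {T : (Fin d → Fin n) → ℝ} {β : Fin n → ℕ} (hβ : ∑ i, β i < d) :
    ∑ y, gridPerturbation q T y * ∏ i, g (y i) ^ β i = 0 := by
  rw [sum_gridPerturbation_mul_monomial hq fun i =>
    (Finset.single_le_sum (fun _ _ => Nat.zero_le _) (Finset.mem_univ i)).trans hβ.le]
  refine Finset.sum_eq_zero fun idx _ => if_neg ?_
  intro h
  rw [← h, sum_fiberCount] at hβ
  exact lt_irrefl _ hβ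

theorem sum_gridPerturbation_mul_monomial_fiberCount
    (hq : ∀ k ≤ d, ∀ l ≤ d, ∑ t, q k t * g t ^ l = if k = l then 1 else 0)
    {T : (Fin d → Fin n) → ℝ} (hT : T ∈ VpmiSubmodule d n) (idx : Fin d → Fin n) :
    ∑ y, gridPerturbation q T y * ∏ i, g (y i) ^ fiberCount idx i = T idx := by
  rw [sum_gridPerturbation_mul_monomial hq (fiberCount_le idx), ← Finset.sum_filter,
    Finset.sum_congr rfl (g := fun _ => T idx *
      (fiberMultiplicity d (fiberCount idx) : ℝ)⁻¹)]
  · rw [Finset.sum_const, nsmul_eq_mul, mul_comm, mul_assoc, fiberMultiplicity,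
      inv_mul_cancel₀, mul_one]
    exact Nat.cast_ne_zero.mpr (Finset.card_ne_zero.mpr ⟨idx, by simp⟩)
  · intro idx' h
    rw [eq_of_fiberCount_eq hT (Finset.mem_filter.mp h).2]

/-- Duality at coordinate `i` forces multiplicity one, and at coordinates other than `i` and `j`
multiplicity zero. Only entries `i j ⋯ j` of `T` remain, and these vanish; nothing is asked at `j`,
so `φ` is arbitrary. -/
theorem sum_gridPerturbation_pmi (hd : d ≠ 0)
    (hq : ∀ k ≤ d, ∀ l ≤ d, ∑ t, q k t * g t ^ l = if k = l then 1 else 0)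
    {T : (Fin d → Fin n) → ℝ} (hT : T ∈ VpmiSubmodule d n) {i j : Fin n} (hij : i ≠ j)
    (φ : ℝ → ℝ) : ∑ y, gridPerturbation q T y * (g (y i) * φ (g (y j))) = 0 := by
  have h1 : ∀ y : Fin n → Fin (d + 1), g (y i) * φ (g (y j))
      = ∏ k, if k = i then g (y k) else if k = j then φ (g (y k)) else 1 := fun y => by
    rw [← Finset.mul_prod_erase _ _ (Finset.mem_univ i),
      ← Finset.mul_prod_erase _ _ (Finset.mem_erase.mpr ⟨hij.symm, Finset.mem_univ j⟩),
      Finset.prod_eq_one]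
    · simp [hij.symm]
    · intro k hk
      simp only [Finset.mem_erase] at hk
      simp [hk.1, hk.2.1]
  simp only [h1]
  rw [sum_gridPerturbation_mul_prod q T fun k t =>
    if k = i then g t else if k = j then φ (g t) else 1]
  refine Finset.sum_eq_zero fun idx _ => ?_
  by_cases hidx : fiberCount idx i = 1 ∧ ∀ k, k ≠ i → k ≠ j → fiberCount idx k = 0
  · rw [eq_zero_of_fiberCount hT hij hidx.1 hidx.2, zero_mul, zero_mul]
  · apply mul_eq_zero_of_right
    rw [not_and_or] at hidx
    rcases hidx with h | h
    · refine Finset.prod_eq_zero (Finset.mem_univ i) ?_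
      have := hq _ (fiberCount_le idx i) 1 (by omega)
      simpa [h] using this
    · push Not at h
      obtain ⟨k, hki, hkj, hk⟩ := h
      refine Finset.prod_eq_zero (Finset.mem_univ k) ?_
      have := hq _ (fiberCount_le idx k) 0 (by omega)
      simpa [hk, hki, hkj] using this

/-- Uniform weights on the grid, perturbed by the tensor `T`. -/
noncomputable def gridWeight (q : ℕ → Fin (d + 1) → ℝ) (T : (Fin d → Fin n) → ℝ)
    (y : Fin n → Fin (d + 1)) : ℝ :=
  ∏ _i : Fin n, ((d : ℝ) + 1)⁻¹ + gridPerturbation q T y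

theorem sum_uniform_mul_prod (F : Fin n → Fin (d + 1) → ℝ) :
    ∑ y : Fin n → Fin (d + 1), (∏ _i : Fin n, ((d : ℝ) + 1)⁻¹) * ∏ i, F i (y i)
      = ∏ i, ((d : ℝ) + 1)⁻¹ * ∑ t, F i t := by
  simp only [← Finset.prod_mul_distrib, Finset.mul_sum]
  exact sum_prod_eq_prod_sum fun i t => ((d : ℝ) + 1)⁻¹ * F i t

/-- The perturbation has no moments below order `d`, so `d ≥ 3` keeps mass, means and variances
those of the uniform law. -/
theorem gridWeight_moments (hd : 3 ≤ d)
    (hq : ∀ k ≤ d, ∀ l ≤ d, ∑ t, q k t * g t ^ l = if k = l then 1 else 0)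
    (hg : ∑ t, g t = 0) (hg2 : ∑ t, g t ^ 2 = d + 1)
    {T : (Fin d → Fin n) → ℝ} (hT : T ∈ VpmiSubmodule d n) :
    ∑ y, gridWeight q T y = 1 ∧ (∀ i, ∑ y, gridWeight q T y * g (y i) = 0) ∧
      (∀ i, ∑ y, gridWeight q T y * g (y i) ^ 2 = 1) ∧
      ∀ i j, i ≠ j → ∀ φ : ℝ → ℝ, ∑ y, gridWeight q T y * (g (y i) * φ (g (y j))) = 0 := by
  have hd0 : (d : ℝ) + 1 ≠ 0 := by positivity
  have hpow : ∀ (i : Fin n) (m : ℕ) (y : Fin n → Fin (d + 1)),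
      g (y i) ^ m = ∏ k, g (y k) ^ (Pi.single i m : Fin n → ℕ) k := fun i m y => by
    rw [Finset.prod_eq_single i] <;> simp +contextual
  have hpert : ∀ (i : Fin n) (m : ℕ), m < d →
      ∑ y, gridPerturbation q T y * g (y i) ^ m = 0 := fun i m hm => by
    simp only [hpow i m]
    exact sum_gridPerturbation_mul_monomial_of_ne hq (by simpa using hm)
  have hunif : ∀ (i : Fin n) (f : Fin (d + 1) → ℝ),
      ∑ y : Fin n → Fin (d + 1), (∏ _i : Fin n, ((d : ℝ) + 1)⁻¹) * f (y i)
        = ((d : ℝ) + 1)⁻¹ * ∑ t, f t := fun i f => by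
    have h1 : ∀ y : Fin n → Fin (d + 1), f (y i) = ∏ k, if k = i then f (y k) else 1 := fun y => by
      rw [Finset.prod_eq_single i] <;> simp +contextual
    simp only [h1]
    rw [sum_uniform_mul_prod fun k t => if k = i then f t else 1, Finset.prod_eq_single i]
    · simp
    · intro k _ hk
      simp [hk, hd0]
    · simp
  simp only [gridWeight, add_mul, Finset.sum_add_distrib]
  refine ⟨?_, fun i => ?_, fun i => ?_, fun i j hij φ => ?_⟩
  · have h1 := sum_uniform_mul_prod (d := d) (n := n) fun _ _ => 1
    have h2 := sum_gridPerturbation_mul_monomial_of_ne (T := T) hq (β := 0) (by simp; omega)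
    simp only [Pi.zero_apply, pow_zero, Finset.prod_const_one, mul_one] at h1 h2
    rw [h1, h2]
    simp [hd0]
  · have := hpert i 1 (by omega)
    simp only [pow_one] at this
    rw [this, hunif i g, hg, mul_zero, add_zero]
  · rw [hpert i 2 (by omega), hunif i fun t => g t ^ 2, hg2, add_zero, inv_mul_cancel₀ hd0]
  · rw [sum_gridPerturbation_pmi (by omega) hq hT hij φ, add_zero]
    have h1 : ∀ y : Fin n → Fin (d + 1), g (y i) * φ (g (y j))
        = ∏ k, if k = i then g (y k) else if k = j then φ (g (y k)) else 1 := fun y => by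
      rw [← Finset.mul_prod_erase _ _ (Finset.mem_univ i),
        ← Finset.mul_prod_erase _ _ (Finset.mem_erase.mpr ⟨hij.symm, Finset.mem_univ j⟩),
        Finset.prod_eq_one]
      · simp [hij.symm]
      · intro k hk
        simp only [Finset.mem_erase] at hk
        simp [hk.1, hk.2.1]
    simp only [h1]
    rw [sum_uniform_mul_prod fun k t => if k = i then g t else if k = j then φ (g t) else 1]
    exact Finset.prod_eq_zero (Finset.mem_univ i) (by simp [hg])

/-- Only the full moment of order `d` changes, by `T`. It enters the cumulant through the one-block
partition alone, with coefficient one. -/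
theorem cumulantTensor_gridMeasure (hd : d ≠ 0)
    (hq : ∀ k ≤ d, ∀ l ≤ d, ∑ t, q k t * g t ^ l = if k = l then 1 else 0)
    {T : (Fin d → Fin n) → ℝ} (hT : T ∈ VpmiSubmodule d n) (hpos : ∀ y, 0 ≤ gridWeight q T y) :
    cumulantTensor (gridMeasure g (gridWeight q T)) (fun y => y) d
      = cumulantTensor (gridMeasure g (gridWeight (n := n) q 0)) (fun y => y) d + T := by
  have h0 : ∀ y : Fin n → Fin (d + 1), gridWeight (d := d) q 0 y = ∏ _i : Fin n, ((d : ℝ) + 1)⁻¹ :=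
    fun y => by simp [gridWeight, gridPerturbation]
  have hpos0 : ∀ y : Fin n → Fin (d + 1), 0 ≤ gridWeight (d := d) q 0 y := fun y => by
    rw [h0]; positivity
  funext idx
  have hmoment : ∀ B : Finset (Fin d),
      ∫ y, ∏ k ∈ B, y (idx k) ∂gridMeasure g (gridWeight q T)
        = (∫ y, ∏ k ∈ B, y (idx k) ∂gridMeasure g (gridWeight (n := n) q 0))
          + if B = Finset.univ then T idx else 0 := by
    intro B
    rw [integral_gridMeasure g hpos, integral_gridMeasure g hpos0]
    simp only [h0]
    simp only [gridWeight, add_mul, Finset.sum_add_distrib]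
    congr 1
    have h1 : ∀ y : Fin n → Fin (d + 1), ∏ k ∈ B, g (y (idx k))
        = ∏ i, g (y i) ^ (B.filter fun k => idx k = i).card := fun y => by
      rw [← Finset.prod_fiberwise' B idx fun i => g (y i)]
      simp
    simp only [h1]
    split_ifs with hB
    · subst hB
      exact sum_gridPerturbation_mul_monomial_fiberCount hq hT idx
    · refine sum_gridPerturbation_mul_monomial_of_ne hq ?_
      have h2 := Finset.card_eq_sum_card_fiberwise (f := idx) (s := B) (t := Finset.univ)
        (fun _ _ => Finset.mem_univ _)
      rw [← h2]
      simpa using Finset.card_lt_card (Finset.ssubset_univ_iff.mpr hB)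
  have huniv : (Finset.univ : Finset (Fin d)) ≠ ⊥ := by
    have : Nonempty (Fin d) := ⟨⟨0, by omega⟩⟩
    exact Finset.univ_nonempty.ne_empty
  rw [Pi.add_apply]
  simp only [cumulantTensor, hmoment]
  rw [← sub_eq_iff_eq_add', ← Finset.sum_sub_distrib,
    Finset.sum_eq_single (Finpartition.indiscrete huniv)]
  · simp
  · intro π _ hπ
    rw [← mul_sub]
    apply mul_eq_zero_of_right
    rw [sub_eq_zero]
    refine Finset.prod_congr rfl fun B hB => ?_
    rw [if_neg, add_zero]
    rintro rfl
    apply hπ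
    ext1
    refine Finset.eq_singleton_iff_unique_mem.mpr ⟨hB, fun C hC => ?_⟩
    obtain ⟨k, hk⟩ := π.nonempty_of_mem_parts hC
    exact π.eq_of_mem_parts hC hB hk (Finset.mem_univ k)
  · simp

theorem exists_centred_nodes (hd : d ≠ 0) : ∃ g : Fin (d + 1) → ℝ, Function.Injective g ∧
    ∑ t, g t = 0 ∧ ∑ t, g t ^ 2 = d + 1 := by
  have hd0 : (d : ℝ) + 1 ≠ 0 := by positivity
  set a : ℝ := (∑ t : Fin (d + 1), ((t : ℕ) : ℝ)) / (d + 1) with ha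
  set V : ℝ := ∑ t : Fin (d + 1), (((t : ℕ) : ℝ) - a) ^ 2 with hV
  have hVpos : 0 < V := by
    by_contra hle
    have h0 : ∀ t : Fin (d + 1), (((t : ℕ) : ℝ) - a) ^ 2 = 0 := fun t =>
      (Finset.sum_eq_zero_iff_of_nonneg fun _ _ => sq_nonneg _).mp
        (le_antisymm (not_lt.mp hle) (Finset.sum_nonneg fun _ _ => sq_nonneg _)) t
        (Finset.mem_univ t)
    have h1 := h0 0
    have h2 := h0 (Fin.last d)
    rw [sq_eq_zero_iff, sub_eq_zero] at h1 h2
    rw [← h1] at h2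
    simp at h2
    exact hd h2
  set c := √((d + 1) / V)
  have hc : 0 < c := Real.sqrt_pos.mpr (by positivity)
  refine ⟨fun t => c * (((t : ℕ) : ℝ) - a), fun s t hst => ?_, ?_, ?_⟩
  · have := mul_left_cancel₀ hc.ne' hst
    exact Fin.ext (by exact_mod_cast sub_left_injective this)
  · rw [← Finset.mul_sum, Finset.sum_sub_distrib, Finset.sum_const, Finset.card_univ,
      Fintype.card_fin, nsmul_eq_mul, ha]
    push_cast
    field_simp
    simp
  · simp only [mul_pow]
    rw [← Finset.mul_sum, ← hV, Real.sq_sqrt (by positivity)]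
    field_simp

/-- The rows of the inverse Vandermonde matrix of the `d + 1` nodes are the dual weights. -/
theorem exists_dual_weights {g : Fin (d + 1) → ℝ} (hg : Function.Injective g) :
    ∃ q : ℕ → Fin (d + 1) → ℝ,
      ∀ k ≤ d, ∀ l ≤ d, ∑ t, q k t * g t ^ l = if k = l then 1 else 0 := by
  have hdet : IsUnit (Matrix.vandermonde g).det :=
    (Matrix.det_vandermonde_ne_zero_iff.mpr hg).isUnit
  refine ⟨fun k t => (Matrix.vandermonde g)⁻¹ (Fin.ofNat (d + 1) k) t, fun k hk l hl => ?_⟩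
  have h := congrFun (congrFun (Matrix.nonsing_inv_mul _ hdet) (Fin.ofNat (d + 1) k))
    (Fin.ofNat (d + 1) l)
  rw [Matrix.mul_apply, Matrix.one_apply] at h
  have hk' : k % (d + 1) = k := Nat.mod_eq_of_lt (by omega)
  have hl' : l % (d + 1) = l := Nat.mod_eq_of_lt (by omega)
  simpa [Matrix.vandermonde_apply, Fin.ext_iff, hk', hl'] using h

/-- The cumulant tensors of standardized pairwise mean independent vectors are Zariski dense in
`Vpmi`. -/
theorem exists_source_eval_cumulantTensor_ne_zero (hd : 3 ≤ d)
    (P : MvPolynomial (Fin d → Fin n) ℝ) {T : (Fin d → Fin n) → ℝ} (hT : T ∈ VpmiSubmodule d n)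
    (hP : MvPolynomial.eval T P ≠ 0) :
    ∃ ν : Measure (Fin n → ℝ), IsProbabilityMeasure ν ∧ IsPMISource ν d (fun y => y) ∧
      MvPolynomial.eval (cumulantTensor ν (standardize ν (fun y => y)) d) P ≠ 0 := by
  obtain ⟨g, hginj, hg, hg2⟩ := exists_centred_nodes (d := d) (by omega)
  obtain ⟨q, hq⟩ := exists_dual_weights hginj
  have hsource : ∀ S ∈ VpmiSubmodule d n, (∀ y, 0 ≤ gridWeight q S y) →
      IsProbabilityMeasure (gridMeasure g (gridWeight q S)) ∧
      IsPMISource (gridMeasure g (gridWeight q S)) d (fun y => y) ∧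
      standardize (gridMeasure g (gridWeight q S)) (fun y => y) = fun y => y := fun S hS hpos => by
    obtain ⟨h1, h2, h3, h4⟩ := gridWeight_moments hd hq hg hg2 hS
    exact ⟨isProbabilityMeasure_gridMeasure g hpos h1,
      isPMISource_gridMeasure g hpos h1 h2 h3 h4 d (by omega)⟩
  set κ₀ := cumulantTensor (gridMeasure g (gridWeight (n := n) q 0)) (fun y => y) d with hκ₀
  have hpos0 : ∀ y : Fin n → Fin (d + 1), 0 < gridWeight (d := d) q 0 y := fun y => by
    have : gridWeight (d := d) q 0 y = ∏ _i : Fin n, ((d : ℝ) + 1)⁻¹ := by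
      simp [gridWeight, gridPerturbation]
    rw [this]; positivity
  have hκ₀mem : κ₀ ∈ VpmiSubmodule d n := by
    obtain ⟨h1, h2, h3⟩ := hsource 0 (Submodule.zero_mem _) fun y => (hpos0 y).le
    refine cumulantTensor_mem_Vpmi fun i j hij m hm => ?_
    have := h2.pmi.integral_standardize_mul_pow h2.measurable h2.memLp hij hm
    rwa [h3] at this
  -- On the segment from `κ₀` to `T` the polynomial is nonzero at `1`, so it has finitely many
  -- roots; near `0` the weights stay positive.
  obtain ⟨Q, hQ⟩ := exists_polynomial_eval_line P κ₀ (T - κ₀)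
  have hQ0 : Q ≠ 0 := by
    rintro rfl
    exact hP (by simpa using (hQ 1).symm)
  have hmem : ∀ t : ℝ, t • (T - κ₀) ∈ VpmiSubmodule d n := fun t =>
    Submodule.smul_mem _ _ (Submodule.sub_mem _ hT hκ₀mem)
  have hev1 : ∀ᶠ t in nhdsWithin (0 : ℝ) {0}ᶜ, ∀ y, 0 < gridWeight q (t • (T - κ₀)) y := by
    refine Filter.Eventually.filter_mono nhdsWithin_le_nhds (Filter.eventually_all.mpr fun y => ?_)
    have hcont : Continuous fun t : ℝ => gridWeight q (t • (T - κ₀)) y := by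
      unfold gridWeight gridPerturbation
      simp only [Pi.smul_apply]
      fun_prop
    refine hcont.continuousAt.eventually (lt_mem_nhds ?_)
    simp only [zero_smul]
    exact hpos0 y
  have hev2 : ∀ᶠ t in nhdsWithin (0 : ℝ) {0}ᶜ, Polynomial.eval t Q ≠ 0 := by
    have hfin : {t | Polynomial.IsRoot Q t}.Finite := Polynomial.finite_setOfPred_isRoot hQ0
    exact (nhdsNE_le_cofinite (0 : ℝ)) hfin.compl_mem_cofinite
  obtain ⟨t, ht1, ht2⟩ := (hev1.and hev2).exists
  obtain ⟨h1, h2, h3⟩ := hsource _ (hmem t) fun y => (ht1 y).le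
  refine ⟨_, h1, h2, ?_⟩
  rw [h3, cumulantTensor_gridMeasure (by omega) hq (hmem t) fun y => (ht1 y).le, ← hQ]
  exact ht2

end Perturbation

/-! ### Whitening and recovery of the mixing matrix -/

section Identification

variable {Ω Ω' : Type*} [MeasurableSpace Ω] [MeasurableSpace Ω'] {n d : ℕ}

theorem integral_comp_eq_of_map_eq {E : Type*} [MeasurableSpace E] {μ : Measure Ω}
    {μ' : Measure Ω'} {X : Ω → E} {X' : Ω' → E} (hX : Measurable X) (hX' : Measurable X')
    (h : μ.map X = μ'.map X') {f : E → ℝ} (hf : Measurable f) :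
    ∫ ω, f (X ω) ∂μ = ∫ ω, f (X' ω) ∂μ' := by
  rw [← integral_map hX.aemeasurable hf.aestronglyMeasurable, h,
    integral_map hX'.aemeasurable hf.aestronglyMeasurable]

theorem jointCumulant_comp_eq_of_map_eq {E : Type*} [MeasurableSpace E] {μ : Measure Ω}
    {μ' : Measure Ω'} {X : Ω → E} {X' : Ω' → E} (hX : Measurable X) (hX' : Measurable X')
    (h : μ.map X = μ'.map X') {f : Fin d → E → ℝ} (hf : ∀ k, Measurable (f k)) :
    jointCumulant μ (fun k ω => f k (X ω)) = jointCumulant μ' fun k ω => f k (X' ω) := by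
  refine Finset.sum_congr rfl fun π _ => ?_
  congr 1
  refine Finset.prod_congr rfl fun B _ => ?_
  exact integral_comp_eq_of_map_eq hX hX' h (f := fun x => ∏ k ∈ B, f k x)
    (Finset.measurable_prod _ fun k _ => hf k)

theorem integral_standardize_mul {μ : Measure Ω} [IsProbabilityMeasure μ] {s : Ω → Fin n → ℝ}
    (hs : PairwiseMeanIndep μ s) (hm : Measurable s) (hd : 2 ≤ d)
    (hmem : ∀ i, MemLp (fun ω => s ω i) d μ) (hvar : ∀ i, variance (fun ω => s ω i) μ ≠ 0)
    (i j : Fin n) :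
    ∫ ω, standardize μ s ω i * standardize μ s ω j ∂μ = if i = j then 1 else 0 := by
  split_ifs with hij
  · subst hij
    have hv : 0 < variance (fun ω => s ω i) μ :=
      lt_of_le_of_ne (variance_nonneg _ _) (hvar i).symm
    calc ∫ ω, standardize μ s ω i * standardize μ s ω i ∂μ
        = ∫ ω, (variance (fun ω => s ω i) μ)⁻¹ * (s ω i - ∫ ω', s ω' i ∂μ) ^ 2 ∂μ := by
          refine integral_congr_ae (Filter.Eventually.of_forall fun ω => ?_)
          simp only [standardize]
          rw [div_mul_div_comm, Real.mul_self_sqrt hv.le]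
          ring
      _ = 1 := by
          rw [integral_const_mul, ← variance_eq_integral (X := fun ω => s ω i)
            ((measurable_pi_apply i).comp hm).aemeasurable, inv_mul_cancel₀ hv.ne']
  · simpa using hs.integral_standardize_mul_pow hm hmem hij (m := 1) (by omega)

/-- The whitening of the mixing matrix between two pairwise mean independent vectors is
orthogonal, and it transforms one standardized vector into the other. -/
theorem exists_orthogonal_of_map_eq {μ : Measure Ω} [IsProbabilityMeasure μ] {μ' : Measure Ω'}
    [IsProbabilityMeasure μ'] {s : Ω → Fin n → ℝ} {s' : Ω' → Fin n → ℝ} (hd : 2 ≤ d)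
    (hs : IsPMISource μ d s) (hm' : Measurable s') (hs' : PairwiseMeanIndep μ' s')
    {M : Matrix (Fin n) (Fin n) ℝ} (hM : M.det ≠ 0)
    (hmap : μ.map (fun ω => M.mulVec (s ω)) = μ'.map s') :
    (∀ i, MemLp (fun ω => s' ω i) d μ') ∧ ∃ Q : Matrix (Fin n) (Fin n) ℝ, Q * Q.transpose = 1 ∧
      (∃ x y : Fin n → ℝ, (∀ i, x i ≠ 0) ∧ (∀ i, y i ≠ 0) ∧ ∀ i j, M i j = x i * Q i j * y j) ∧
      μ.map (fun ω => Q.mulVec (standardize μ s ω)) = μ'.map (standardize μ' s') := by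
  have hMs : Measurable fun ω => M.mulVec (s ω) := by
    refine measurable_pi_lambda _ fun i => ?_
    simp only [Matrix.mulVec, dotProduct]
    exact Finset.measurable_sum _ fun j _ =>
      ((measurable_pi_apply j).comp hs.measurable).const_mul _
  have hmem' : ∀ i, MemLp (fun ω => s' ω i) d μ' := fun i => by
    have h1 : MemLp (fun x : Fin n → ℝ => x i) d (μ'.map s') := by
      rw [← hmap, memLp_map_measure_iff (measurable_pi_apply i).aestronglyMeasurable hMs.aemeasurable]
      have : (fun x : Fin n → ℝ => x i) ∘ (fun ω => M.mulVec (s ω))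
          = fun ω => ∑ j, M i j * s ω j := rfl
      rw [this]
      exact memLp_finsetSum _ fun j _ => (hs.memLp j).const_mul _
    rwa [memLp_map_measure_iff (measurable_pi_apply i).aestronglyMeasurable hm'.aemeasurable] at h1
  set σ : Fin n → ℝ := fun j => √(variance (fun ω => s ω j) μ) with hσ
  set σ' : Fin n → ℝ := fun j => √(variance (fun ω => s' ω j) μ') with hσ'
  have hσ0 : ∀ j, σ j ≠ 0 := fun j => by
    have : 0 < variance (fun ω => s ω j) μ :=
      lt_of_le_of_ne (variance_nonneg _ _) (hs.variance_ne_zero j).symm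
    exact (Real.sqrt_pos.mpr this).ne'
  set z := standardize μ s with hz
  have hzmem : ∀ i, MemLp (fun ω => z ω i) d μ := memLp_standardize hs.memLp
  have hzz : ∀ i j, ∫ ω, z ω i * z ω j ∂μ = if i = j then 1 else 0 :=
    integral_standardize_mul hs.pmi hs.measurable hd hs.memLp hs.variance_ne_zero
  have hmean : ∀ i, ∫ ω, s' ω i ∂μ' = ∑ j, M i j * ∫ ω, s ω j ∂μ := fun i => by
    rw [← integral_comp_eq_of_map_eq hMs hm' hmap (measurable_pi_apply i)]
    simp only [Matrix.mulVec, dotProduct]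
    rw [integral_finsetSum _ fun j _ => (hs.pmi.1 j).const_mul _]
    simp only [integral_const_mul]
  have hcent : ∀ i ω, M.mulVec (s ω) i - ∫ ω, s' ω i ∂μ' = ∑ j, M i j * σ j * z ω j := by
    intro i ω
    rw [hmean]
    simp only [Matrix.mulVec, dotProduct]
    rw [← Finset.sum_sub_distrib]
    refine Finset.sum_congr rfl fun j _ => ?_
    have h1 : σ j * z ω j = s ω j - ∫ ω, s ω j ∂μ := mul_div_cancel₀ _ (hσ0 j)
    rw [mul_assoc, h1]
    ring
  have hprod : ∀ (c c' : Fin n → ℝ),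
      ∫ ω, (∑ j, c j * z ω j) * (∑ j, c' j * z ω j) ∂μ = ∑ j, c j * c' j := by
    intro c c'
    have hint : ∀ i j, Integrable (fun ω => (c i * c' j) * (z ω i * z ω j)) μ := fun i j => by
      refine Integrable.const_mul ?_ _
      have h2 : ∀ i, MemLp (fun ω => z ω i) 2 μ := fun i =>
        (hzmem i).mono_exponent (by exact_mod_cast hd)
      exact (h2 i).integrable_mul (h2 j)
    have h1 : ∀ ω, (∑ j, c j * z ω j) * (∑ j, c' j * z ω j)
        = ∑ i, ∑ j, (c i * c' j) * (z ω i * z ω j) := fun ω => by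
      rw [Finset.sum_mul_sum]
      exact Finset.sum_congr rfl fun i _ => Finset.sum_congr rfl fun j _ => by ring
    simp only [h1]
    rw [integral_finsetSum _ fun i _ => integrable_finsetSum _ fun j _ => hint i j]
    refine Finset.sum_congr rfl fun i _ => ?_
    rw [integral_finsetSum _ fun j _ => hint i j]
    simp only [integral_const_mul, hzz]
    simp
  have hcov : ∀ i k, ∫ ω, (s' ω i - ∫ ω, s' ω i ∂μ') * (s' ω k - ∫ ω, s' ω k ∂μ') ∂μ'
      = ∑ j, (M i j * σ j) * (M k j * σ j) := fun i k => by
    rw [← hprod, ← integral_comp_eq_of_map_eq hMs hm' hmap (f := fun x =>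
      (x i - ∫ ω, s' ω i ∂μ') * (x k - ∫ ω, s' ω k ∂μ')) (by fun_prop)]
    simp only [hcent]
  have hvar' : ∀ i, variance (fun ω => s' ω i) μ' = ∑ j, (M i j * σ j) ^ 2 := fun i => by
    rw [variance_eq_integral (X := fun ω => s' ω i) ((measurable_pi_apply i).comp hm').aemeasurable]
    simp only [pow_two]
    exact hcov i i
  -- A degenerate coordinate of `s'` would be a zero row of `M`; nondegeneracy of `s'` need not be
  -- assumed.
  have hvar0 : ∀ i, variance (fun ω => s' ω i) μ' ≠ 0 := fun i h0 => by
    rw [hvar', Finset.sum_eq_zero_iff_of_nonneg fun _ _ => sq_nonneg _] at h0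
    refine hM (Matrix.det_eq_zero_of_row_eq_zero i fun j => ?_)
    have := pow_eq_zero_iff two_ne_zero |>.mp (h0 j (Finset.mem_univ j))
    exact (mul_eq_zero.mp this).resolve_right (hσ0 j)
  have hσ'0 : ∀ j, σ' j ≠ 0 := fun j => by
    have : 0 < variance (fun ω => s' ω j) μ' :=
      lt_of_le_of_ne (variance_nonneg _ _) (hvar0 j).symm
    exact (Real.sqrt_pos.mpr this).ne'
  set Q : Matrix (Fin n) (Fin n) ℝ := Matrix.of fun i j => M i j * σ j / σ' i with hQ
  have hQz : ∀ ω i, (Q.mulVec (z ω)) i = (M.mulVec (s ω) i - ∫ ω, s' ω i ∂μ') / σ' i := by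
    intro ω i
    rw [hcent, Finset.sum_div]
    simp only [Matrix.mulVec, dotProduct, hQ, Matrix.of_apply]
    exact Finset.sum_congr rfl fun j _ => by ring
  have hlaw : μ.map (fun ω => Q.mulVec (z ω)) = μ'.map (standardize μ' s') := by
    let f : (Fin n → ℝ) → Fin n → ℝ := fun x i => (x i - ∫ ω, s' ω i ∂μ') / σ' i
    have hf : Measurable f := by fun_prop
    have h1 : (fun ω => Q.mulVec (z ω)) = f ∘ fun ω => M.mulVec (s ω) := by
      funext ω i
      exact hQz ω i
    have h2 : standardize μ' s' = f ∘ s' := rfl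
    rw [h1, h2, ← Measure.map_map hf hMs, ← Measure.map_map hf hm', hmap]
  refine ⟨hmem', Q, ?_, ⟨σ', fun j => (σ j)⁻¹, hσ'0, fun j => inv_ne_zero (hσ0 j), fun i j => ?_⟩,
    hlaw⟩
  -- `Q * Qᵀ` is the covariance matrix of the standardized `s'`, which is the identity.
  · ext i k
    rw [Matrix.mul_apply, Matrix.one_apply,
      ← integral_standardize_mul hs' hm' hd hmem' hvar0 i k]
    have h1 : ∫ ω, standardize μ' s' ω i * standardize μ' s' ω k ∂μ'
        = (σ' i * σ' k)⁻¹ * ∫ ω, (s' ω i - ∫ ω, s' ω i ∂μ') * (s' ω k - ∫ ω, s' ω k ∂μ') ∂μ' := by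
      rw [← integral_const_mul]
      refine integral_congr_ae (Filter.Eventually.of_forall fun ω => ?_)
      simp only [standardize, hσ']
      rw [div_mul_div_comm]
      ring
    rw [h1, hcov, Finset.mul_sum]
    refine Finset.sum_congr rfl fun j _ => ?_
    simp only [hQ, Matrix.transpose_apply, Matrix.of_apply]
    rw [div_mul_div_comm]
    ring
  · have h1 := hσ0 j
    have h2 := hσ'0 i
    simp only [hQ, Matrix.of_apply]
    field_simp

/-- An orthogonal matrix whose rows have at most one nonzero entry is a signed permutation. -/
theorem exists_perm_of_orthogonal_rows {Q : Matrix (Fin n) (Fin n) ℝ} (hQ : Q * Q.transpose = 1)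
    (hrow : ∀ j a b, Q j a ≠ 0 → Q j b ≠ 0 → a = b) :
    ∃ τ : Equiv.Perm (Fin n), ∀ j a, Q j a ≠ 0 ↔ a = τ j := by
  have horth : ∀ i k, ∑ l, Q i l * Q k l = if i = k then 1 else 0 := fun i k => by
    have := congrFun (congrFun hQ i) k
    rw [Matrix.one_apply] at this
    simpa [Matrix.mul_apply] using this
  have hex : ∀ j, ∃ a, Q j a ≠ 0 := fun j => by
    by_contra! h0
    have := horth j j
    simp [h0] at this
  choose f hf using hex
  -- Two rows supported in the same column would not be orthogonal.
  have hfinj : Function.Injective f := fun i k hik => by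
    by_contra hne
    have := horth i k
    rw [if_neg hne, Finset.sum_eq_single (f i) (fun l _ hl => ?_) (by simp)] at this
    · exact (mul_ne_zero (hf i) (hik ▸ hf k)) this
    · by_cases h0 : Q i l = 0
      · rw [h0, zero_mul]
      · exact absurd (hrow i l (f i) h0 (hf i)) hl
  refine ⟨Equiv.ofBijective f (Finite.injective_iff_bijective.mp hfinj), fun j a => ⟨fun h => ?_, ?_⟩⟩
  · exact hrow j a (f j) h (hf j)
  · rintro rfl
    exact hf j

/-- By multilinearity this contraction is the entry `i j ⋯ j` of the cumulant tensor of `Q z`, hence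
of `z'`. -/
theorem contract_cumulantTensor_eq_zero_of_map_eq {e : ℕ} {μ : Measure Ω} [IsProbabilityMeasure μ]
    {μ' : Measure Ω'} {z : Ω → Fin n → ℝ} {z' : Ω' → Fin n → ℝ} (hm : Measurable z)
    (hm' : Measurable z') (hz : ∀ i, MemLp (fun ω => z ω i) ((e + 1 : ℕ) : ENNReal) μ)
    (hz' : cumulantTensor μ' z' (e + 1) ∈ VpmiSubmodule (e + 1) n) {Q : Matrix (Fin n) (Fin n) ℝ}
    (hmap : μ.map (fun ω => Q.mulVec (z ω)) = μ'.map z') {i j : Fin n} (hij : i ≠ j) :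
    contract (Q j) (Q i) (cumulantTensor μ z (e + 1)) = 0 := by
  have hQm : Measurable fun ω => Q.mulVec (z ω) := by
    refine measurable_pi_lambda _ fun i => ?_
    simp only [Matrix.mulVec, dotProduct]
    exact Finset.measurable_sum _ fun j _ => ((measurable_pi_apply j).comp hm).const_mul _
  let idx : Fin (e + 1) → Fin n := Function.update (fun _ => j) 0 i
  rw [contract_cumulantTensor μ hz, ← hz'.2 0 i j hij, cumulantTensor_eq_jointCumulant,
    ← jointCumulant_comp_eq_of_map_eq hQm hm' hmap (f := fun k x => x (idx k))
      (fun k => measurable_pi_apply _)]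
  congr 1
  funext k ω
  refine Fin.cases ?_ (fun k => ?_) k
  · simp [idx, Matrix.mulVec, dotProduct]
  · simp [idx, Matrix.mulVec, dotProduct]

theorem measurable_standardize {μ : Measure Ω} {s : Ω → Fin n → ℝ} (hs : Measurable s) :
    Measurable (standardize μ s) :=
  measurable_pi_lambda _ fun i =>
    (((measurable_pi_apply i).comp hs).sub_const _).div_const _

end Identification

/-! ### The identifiability theorem -/

theorem theorem1p2 (n d : ℕ) (hd : 3 ≤ d) :
    ∃ P : MvPolynomial (Fin d → Fin n) ℝ,
      -- the condition `P ≠ 0` is generic on the tensors in `V_pmi` ...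
      (∃ T ∈ Vpmi d n, MvPolynomial.eval T P ≠ 0) ∧
      -- ... and it holds for some pairwise mean independent source distribution
      (∃ ν : Measure (Fin n → ℝ), IsProbabilityMeasure ν ∧ IsPMISource ν d (fun y => y) ∧
        MvPolynomial.eval (cumulantTensor ν (standardize ν (fun y => y)) d) P ≠ 0) ∧
      -- identifiability of the mixing matrix from the distribution of `A s`
      ∀ {Ω : Type*} [MeasurableSpace Ω] (μ : Measure Ω) [IsProbabilityMeasure μ]
        (s : Ω → Fin n → ℝ) (A : Matrix (Fin n) (Fin n) ℝ),
        IsPMISource μ d s → IsUnit A.det →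
        MvPolynomial.eval (cumulantTensor μ (standardize μ s) d) P ≠ 0 →
        ∀ {Ω' : Type*} [MeasurableSpace Ω'] (μ' : Measure Ω') [IsProbabilityMeasure μ']
          (s' : Ω' → Fin n → ℝ) (B : Matrix (Fin n) (Fin n) ℝ),
          Measurable s' → PairwiseMeanIndep μ' s' → IsUnit B.det →
          μ'.map (fun ω => B.mulVec (s' ω)) = μ.map (fun ω => A.mulVec (s ω)) →
          ∃ (σ : Equiv.Perm (Fin n)) (c : Fin n → ℝ),
            (∀ j, c j ≠ 0) ∧ ∀ i j, B i (σ j) = c j * A i j := by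
  obtain ⟨e, rfl⟩ : ∃ e, d = e + 1 := ⟨d - 1, by omega⟩
  obtain ⟨P, ⟨T, hT, hTP⟩, hP⟩ := eventually_orthogonal_eigenbasis_monomial (n := n) (e := e)
    (by omega)
  refine ⟨P, ⟨T, hT, hTP⟩, exists_source_eval_cumulantTensor_ne_zero hd P hT hTP, ?_⟩
  intro Ω _ μ _ s A hs hA hPs Ω' _ μ' _ s' B hm' hs' hB hmap
  have hmeas : ∀ C : Matrix (Fin n) (Fin n) ℝ, Measurable C.mulVec := fun C => by
    refine measurable_pi_lambda _ fun i => ?_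
    simp only [Matrix.mulVec, dotProduct]
    fun_prop
  set M := B⁻¹ * A with hM
  have hMdet : M.det ≠ 0 := by
    rw [hM, Matrix.det_mul]
    exact mul_ne_zero (Matrix.isUnit_nonsing_inv_det B hB).ne_zero hA.ne_zero
  have hBM : B * M = A := by rw [hM, ← mul_assoc, Matrix.mul_nonsing_inv B hB, one_mul]
  have hmapM : μ.map (fun ω => M.mulVec (s ω)) = μ'.map s' := by
    have h1 := congrArg (Measure.map (B⁻¹).mulVec) hmap
    have hBs' : Measurable fun ω => B.mulVec (s' ω) := (hmeas B).comp hm'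
    have hAs : Measurable fun ω => A.mulVec (s ω) := (hmeas A).comp hs.measurable
    rw [Measure.map_map (hmeas _) hBs', Measure.map_map (hmeas _) hAs] at h1
    have h2 : (B⁻¹).mulVec ∘ (fun ω => B.mulVec (s' ω)) = s' := by
      funext ω
      simp [Function.comp, Matrix.mulVec_mulVec, Matrix.nonsing_inv_mul B hB]
    have h3 : (B⁻¹).mulVec ∘ (fun ω => A.mulVec (s ω)) = fun ω => M.mulVec (s ω) := by
      funext ω
      simp [Function.comp, Matrix.mulVec_mulVec, hM]
    rw [h2, h3] at h1
    exact h1.symm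
  obtain ⟨hmem', Q, hQ, ⟨x, y, hx, hy, hMQ⟩, hlaw⟩ :=
    exists_orthogonal_of_map_eq (by omega) hs hm' hs' hMdet hmapM
  have hκ : cumulantTensor μ (standardize μ s) (e + 1) ∈ VpmiSubmodule (e + 1) n :=
    cumulantTensor_mem_Vpmi fun i j hij m hm =>
      hs.pmi.integral_standardize_mul_pow hs.measurable hs.memLp hij hm
  have hκ' : cumulantTensor μ' (standardize μ' s') (e + 1) ∈ VpmiSubmodule (e + 1) n :=
    cumulantTensor_mem_Vpmi fun i j hij m hm =>
      hs'.integral_standardize_mul_pow hm' hmem' hij hm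
  obtain ⟨τ, hτ⟩ := exists_perm_of_orthogonal_rows hQ (hP _ hκ hPs Q hQ fun i j hij =>
    contract_cumulantTensor_eq_zero_of_map_eq (measurable_standardize hs.measurable)
      (measurable_standardize hm') (memLp_standardize hs.memLp) hκ' hlaw hij)
  have hM0 : ∀ j, M (τ.symm j) j ≠ 0 := fun j => by
    rw [hMQ]
    exact mul_ne_zero (mul_ne_zero (hx _) ((hτ _ _).mpr (by simp))) (hy _)
  -- `A = B * M`, and column `j` of `M` has its only nonzero entry in row `τ.symm j`; the scaling is
  -- the inverse of that entry.
  refine ⟨τ.symm, fun j => (M (τ.symm j) j)⁻¹, fun j => inv_ne_zero (hM0 j), fun i j => ?_⟩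
  have hA' : A i j = B i (τ.symm j) * M (τ.symm j) j := by
    conv_lhs => rw [← hBM, Matrix.mul_apply]
    refine Finset.sum_eq_single _ (fun k _ hk => ?_) (by simp)
    have : Q k j = 0 := by
      by_contra h0
      exact hk (by rw [(hτ k j).mp h0, Equiv.symm_apply_apply])
    rw [hMQ, this]
    ring
  rw [hA']
  have := hM0 j
  field_simp
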